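/- Let $q_0>0$, $\tau\in\mathbb R$, $q_\pm\in\mathbb C$ with $|q_\pm|=q_0$, and let $q:\mathbb R\times\mathbb R\to\mathbb C$, $q=q(x,t)$, be such that for every $t$ the function $x\mapsto q(x,t)$ is continuous, $q(x,t)\to q_\pm$ as $x\to\pm\infty$, $q(\cdot,t)-q_-\in L^1(-\infty,0)$ and $q(\cdot,t)-q_+\in L^1(0,\infty)$. (In the application $q$ solves the higher-order dispersive nonlinear Schrödinger equation $iq_t+q_{xx}+2(|q|^2-3\tau q_0^4-q_0^2)q+\tau(q_{xxxx}+8|q|^2q_{xx}+2q^2q^*_{xx}+4q|q_x|^2+6q^*q_x^2+6|q|^4q)=0$; the statement holds at each fixed time $t$, and this equation is not required.) Notation: $^*$ is (entrywise) complex conjugation, $\lambda(z)=\frac12(z+q_0^2/z)$, $k(z)=\frac12(z-q_0^2/z)$, $\sigma_3=\mathrm{diag}(1,-1)$, $\sigma=\begin{pmatrix}0&1\\-1&0\end{pmatrix}$, $Q=\begin{pmatrix}0&q\\-q^*&0\end{pmatrix}$, $Q_\pm=\begin{pmatrix}0&q_\pm\\-q_\pm^*&0\end{pmatrix}$, $Y_\pm(z)=I-\frac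 iz\sigma_3Q_\pm$, $\gamma(z)=\det Y_\pm(z)=1+q_0^2/z^2$, $\theta(x,t;z)=\lambda[x+(-8\tau k^3+2k+4\tau kq_0^2)t]$. Let $\Sigma=\mathbb R\cup\{|z|=q_0\}$, $\Sigma_0=\Sigma\setminus\{0,\pm iq_0\}$, and $D_\pm=\{z:\pm(|z|^2-q_0^2)\operatorname{Im}z>0\}$. The Jost solutions $\phi_\pm$, with columns $\phi_{\pm,1},\phi_{\pm,2}$, are the solutions of $\phi_x=(-ik\sigma_3+Q)\phi$ with $\phi_\pm e^{i\theta\sigma_3}\to Y_\pm(z)$ as $x\to\pm\infty$ (column by column). On $\Sigma_0$ the scattering matrix $S=(s_{ij})$ is defined by $\phi_+=\phi_-S$. Further, $s_{11}=\det(\phi_{+,1},\phi_{-,2})/\gamma$ on $D_-\cup\Sigma_0$ and $s_{22}=\det(\phi_{-,1},\phi_{+,2})/\gamma$ on $D_+\cup\Sigma_0$. The discrete spectrum is the set of $z\in\mathbb C\setminus\Sigma$ for which $\phi_x=(-ik\sigma_3+Q)\phi$ has a nonzero solution $\phi(\cdot,t)\in L^2(\mathbb R;\mathbb C^2)$. Theorem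 2.5. For every $t$ these objects are well defined: the columns $\phi_{-,1},\phi_{+,2}$ exist and are unique for $z\in D_+\cup\Sigma_0$, and $\phi_{-,2},\phi_{+,1}$ for $z\in D_-\cup\Sigma_0$; for $z\in\Sigma_0$, $\phi_-$ is invertible, $S$ does not depend on $x$, and its diagonal entries are the $s_{11},s_{22}$ just defined. For $z\in\Sigma_0$, $$S(z)=-\sigma S^*(z^*)\sigma,\qquad S(z)=(\sigma_3Q_-)^{-1}S(-q_0^2/z)\,\sigma_3Q_+ .$$ Moreover $$s_{22}(z)=s_{11}^*(z^*)\ (z\in D_+\cup\Sigma_0),\qquad s_{12}(z)=-s_{21}^*(z^*)\ (z\in\Sigma_0),$$ $$s_{11}(z)=\frac{q_+^*}{q_-^*}\,s_{22}(-q_0^2/z)\ (z\in D_-\cup\Sigma_0),\qquad s_{12}(z)=\frac{q_+}{q_-^*}\,s_{21}(-q_0^2/z)\ (z\in\Sigma_0).$$ The discrete spectrum equals $\{z\in D_-:s_{11}(z)=0\}\cup\{z\in D_+:s_{22}(z)=0\}$, and this set is the union of the quartets $\{z_n,\,-q_0^2/z_n^*,\,z_n^*,\,-q_0^2/z_n\}$,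 each of four distinct points, over all $z_n\in D_-$ with $\operatorname{Im}z_n<0$ and $s_{11}(z_n)=0$. -/

import Mathlib

open Filter Topology MeasureTheory

noncomputable section

namespace HDNLS

/-- `λ(z) = (z + q₀²/z)/2`. -/
def lam (q0 : ℝ) (z : ℂ) : ℂ := (z + (q0 : ℂ) ^ 2 / z) / 2

/-- `k(z) = (z - q₀²/z)/2`. -/
def kk (q0 : ℝ) (z : ℂ) : ℂ := (z - (q0 : ℂ) ^ 2 / z) / 2

/-- `D₊`, the region `Im λ > 0` of the `z`-plane. -/
def Dplus (q0 : ℝ) : Set ℂ := {z | 0 < (‖z‖ ^ 2 - q0 ^ 2) * z.im}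

/-- `D₋`, the region `Im λ < 0` of the `z`-plane. -/
def Dminus (q0 : ℝ) : Set ℂ := {z | (‖z‖ ^ 2 - q0 ^ 2) * z.im < 0}

/-- The continuous spectrum `Σ`: the real line together with the circle of radius `q₀`. -/
def contSpec (q0 : ℝ) : Set ℂ := {z | z.im = 0 ∨ ‖z‖ = q0}

/-- `Σ` without the branch points `± i q₀` and without the point `0`, at which
`λ` and `k` are not defined. -/
def contSpec0 (q0 : ℝ) : Set ℂ :=
  contSpec q0 \ {0, Complex.I * (q0 : ℂ), -(Complex.I * (q0 : ℂ))}

/-- The Pauli matrix `σ₃ = diag(1, -1)`. -/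
def sigma3 : Matrix (Fin 2) (Fin 2) ℂ := !![1, 0; 0, -1]

/-- `σ = (0, 1; -1, 0)`. -/
def sigma : Matrix (Fin 2) (Fin 2) ℂ := !![0, 1; -1, 0]

/-- The off-diagonal matrix `(0, w; -w*, 0)` of a potential value `w`. -/
def Qmat (w : ℂ) : Matrix (Fin 2) (Fin 2) ℂ := !![0, w; -(starRingEnd ℂ w), 0]

/-- The coefficient `X = -i k σ₃ + Q` of the `x`-part of the Lax pair. -/
def Xmat (k w : ℂ) : Matrix (Fin 2) (Fin 2) ℂ := (-(Complex.I * k)) • sigma3 + Qmat w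

/-- `Y(z) = 1 - (i/z) σ₃ Q`, for the asymptotic value `w` of the potential. -/
def Ymat (w z : ℂ) : Matrix (Fin 2) (Fin 2) ℂ := 1 - (Complex.I / z) • (sigma3 * Qmat w)

/-- `γ(z) = det Y(z) = 1 + q₀²/z²`. -/
def gam (q0 : ℝ) (z : ℂ) : ℂ := 1 + (q0 : ℂ) ^ 2 / z ^ 2

/-- `θ(x,t;z) = λ [x + (-8 τ k³ + 2 k + 4 τ k q₀²) t]`. -/
def theta (q0 τ x t : ℝ) (z : ℂ) : ℂ :=
  lam q0 z * ((x : ℂ) + (-8 * (τ : ℂ) * kk q0 z ^ 3 + 2 * kk q0 z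
    + 4 * (τ : ℂ) * kk q0 z * (q0 : ℂ) ^ 2) * (t : ℂ))

/-- `v` solves the scattering problem `v_x = X v` on the whole line, at time `t`. -/
def IsScatteringSolution (q : ℝ → ℝ → ℂ) (q0 t : ℝ) (z : ℂ) (v : ℝ → Fin 2 → ℂ) : Prop :=
  ∀ x : ℝ, HasDerivAt v ((Xmat (kk q0 z) (q x t)).mulVec (v x)) x

/-- `v` is the `j`-th column of a Jost solution with `φ ∼ Y e^{-i θ σ₃}` as `x → ±∞`. The end of
the line is the filter `F` (`atTop` or `atBot`) and `w` is the limit of the potential there. The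
asymptotic condition is that the `j`-th column of `μ = φ e^{i θ σ₃}` tends to that of `Y`. -/
def IsJostColumn (F : Filter ℝ) (w : ℂ) (q : ℝ → ℝ → ℂ) (q0 τ t : ℝ) (z : ℂ) (j : Fin 2)
    (v : ℝ → Fin 2 → ℂ) : Prop :=
  IsScatteringSolution q q0 t z v ∧
    Tendsto (fun x : ℝ => Complex.exp (Complex.I * theta q0 τ x t z * sigma3 j j) • v x) F
      (𝓝 (fun i => Ymat w z i j))

/-- The `j`-th Jost column (the unique `v` with `IsJostColumn`, where there is one). -/
def jostColumn (F : Filter ℝ) (w : ℂ) (q : ℝ → ℝ → ℂ) (q0 τ t : ℝ) (z : ℂ) (j : Fin 2) :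
    ℝ → Fin 2 → ℂ :=
  Classical.epsilon (IsJostColumn F w q q0 τ t z j)

/-- The Jost matrix `φ(x,t;z)` with its two Jost columns. -/
def jost (F : Filter ℝ) (w : ℂ) (q : ℝ → ℝ → ℂ) (q0 τ t : ℝ) (z : ℂ) (x : ℝ) :
    Matrix (Fin 2) (Fin 2) ℂ :=
  Matrix.of fun i j => jostColumn F w q q0 τ t z j x i

/-- The Wronskian `Wr(u, v)` of two vectors, the determinant of the matrix with columns
`u` and `v`. -/
def wr (u v : Fin 2 → ℂ) : ℂ := u 0 * v 1 - u 1 * v 0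

/-- The scattering matrix `S`, defined by `φ₊ = φ₋ S` and read off at `x = 0`. -/
def scatteringMatrix (qm qp : ℂ) (q : ℝ → ℝ → ℂ) (q0 τ t : ℝ) (z : ℂ) :
    Matrix (Fin 2) (Fin 2) ℂ :=
  (jost atBot qm q q0 τ t z 0)⁻¹ * jost atTop qp q q0 τ t z 0

/-- `s₁₁ = Wr(φ₊,₁, φ₋,₂)/γ`, on `D₋` as well as on `Σ`. -/
def s11 (qm qp : ℂ) (q : ℝ → ℝ → ℂ) (q0 τ t : ℝ) (z : ℂ) : ℂ :=
  wr (jostColumn atTop qp q q0 τ t z 0 0) (jostColumn atBot qm q q0 τ t z 1 0) / gam q0 z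

/-- `s₂₂ = Wr(φ₋,₁, φ₊,₂)/γ`, on `D₊` as well as on `Σ`. -/
def s22 (qm qp : ℂ) (q : ℝ → ℝ → ℂ) (q0 τ t : ℝ) (z : ℂ) : ℂ :=
  wr (jostColumn atBot qm q q0 τ t z 0 0) (jostColumn atTop qp q q0 τ t z 1 0) / gam q0 z

/-- The discrete spectrum: the points off `Σ` at which the scattering problem has a nonzero
solution in `L²(ℝ)`. -/
def discreteSpectrum (q : ℝ → ℝ → ℂ) (q0 t : ℝ) : Set ℂ :=
  {z | z ∉ contSpec q0 ∧ ∃ v : ℝ → Fin 2 → ℂ,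
    v ≠ 0 ∧ IsScatteringSolution q q0 t z v ∧ MemLp v 2 volume}

/-- The zeros of `s₁₁` in `D₋` and of `s₂₂` in `D₊`. -/
def zeroSet (qm qp : ℂ) (q : ℝ → ℝ → ℂ) (q0 τ t : ℝ) : Set ℂ :=
  {z | z ∈ Dminus q0 ∧ s11 qm qp q q0 τ t z = 0} ∪
    {z | z ∈ Dplus q0 ∧ s22 qm qp q q0 τ t z = 0}

/-- The quartet `{z, -q₀²/z*, z*, -q₀²/z}`. -/
def quartet (q0 : ℝ) (z : ℂ) : Set ℂ :=
  {z, -(q0 : ℂ) ^ 2 / starRingEnd ℂ z, starRingEnd ℂ z, -(q0 : ℂ) ^ 2 / z}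

end HDNLS

end

namespace HDNLS

/-! Everything is done at one fixed time; `t` enters the normalisation only through the phase `θ`.

Existence is proved for a single Jost column, the first one at `-∞` (`IsJostColumn.exists_atBot`).
The columns of `Y` are eigenvectors of the limiting matrix `-ikσ₃ + Q₋` with eigenvalues `∓iλ`. In
that basis, after removing `e^{-iθ}`, the system is diagonal with entries `0` and `2iλ`, up to a
perturbation bounded by a multiple of `|q - q₋|`, hence integrable near `-∞`. Where `Im λ ≥ 0` the
corresponding Volterra equation is solved on the whole line by one contraction, in a sup norm
weighted by `exp (2 ∫ m)` (`exists_solution_atBot`). Uniqueness comes from the Wronskian, which is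
constant because the coefficient matrix has trace zero.

The other three columns follow by symmetry. The map `v ↦ (-v₂*, v₁*)` with `z ↦ z*` exchanges the
columns. The reflection `x ↦ -x`, `z ↦ -z`, `q ↦ -q(-x)` exchanges the two ends.

By Cramer's rule the entries of `S` are Wronskians of Jost columns divided by `γ`. Conjugation then
gives the first symmetry of `S`. The inversion `z ↦ -q₀²/z` gives the second: it fixes `k`, hence
the differential equation, and reverses the signs of `λ` and `θ`, so it exchanges the columns up to
explicit factors.

In `D₊` the columns `φ₋,₁` and `φ₊,₂` decay exponentially at their own ends. The Wronskian of either
with a square integrable solution is a constant that is integrable on a half-line, hence zero. So an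
eigenfunction exists exactly when the two columns are proportional, that is when `s₂₂ = 0`.
Conjugation carries this to `D₋`. Conjugation and inversion generate a Klein four-group that
permutes the four components of the complement of `Σ` simply transitively, which gives the quartets.
-/

/-! ### Integrals from `-∞` and the Volterra operator -/

theorem hasDerivAt_integral_Iic {E : Type*} [NormedAddCommGroup E] [NormedSpace ℝ E]
    [CompleteSpace E] {f : ℝ → E} (hf : Continuous f)
    (hi : ∀ x, IntegrableOn f (Set.Iic x)) (x : ℝ) :
    HasDerivAt (fun u => ∫ y in Set.Iic u, f y) (f x) x := by
  have h : (fun u => ∫ y in Set.Iic u, f y)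
      = fun u => (∫ y in (0 : ℝ)..u, f y) + ∫ y in Set.Iic 0, f y := by
    funext u
    rw [← intervalIntegral.integral_Iic_sub_Iic (hi 0) (hi u), sub_add_cancel]
  rw [h]
  exact (hf.integral_hasStrictDerivAt 0 x).hasDerivAt.add_const _

theorem tendsto_integral_Iic_atBot {E : Type*} [NormedAddCommGroup E] [NormedSpace ℝ E]
    {f : ℝ → E} (hi : ∀ x, IntegrableOn f (Set.Iic x)) :
    Tendsto (fun u => ∫ y in Set.Iic u, f y) atBot (𝓝 0) := by
  have h := (intervalIntegral_tendsto_integral_Iic (0 : ℝ) (hi 0) tendsto_id).const_sub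
    (∫ y in Set.Iic (0 : ℝ), f y)
  rw [sub_self] at h
  refine h.congr fun u => ?_
  rw [id, ← intervalIntegral.integral_Iic_sub_Iic (hi u) (hi 0), sub_sub_cancel]

/-- The Volterra operator `f ↦ ∫_{-∞}^x e^{μ(x-y)} f(y) dy`. -/
noncomputable def volterra (μ : ℂ) (f : ℝ → ℂ) (x : ℝ) : ℂ :=
  Complex.exp (μ * x) * ∫ y in Set.Iic x, Complex.exp (-μ * y) * f y

theorem integrableOn_exp_mul {μ : ℂ} (hμ : μ.re ≤ 0) {f : ℝ → ℂ}
    (hi : ∀ x, IntegrableOn f (Set.Iic x)) (x : ℝ) :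
    IntegrableOn (fun y : ℝ => Complex.exp (-μ * y) * f y) (Set.Iic x) := by
  refine Integrable.bdd_mul (c := Real.exp (-μ.re * x)) (hi x)
    (by fun_prop : Continuous fun y : ℝ => Complex.exp (-μ * y)).aestronglyMeasurable ?_
  filter_upwards [ae_restrict_mem measurableSet_Iic] with y hy
  rw [Complex.norm_exp]
  have : y ≤ x := hy
  simp only [Complex.mul_re, Complex.neg_re, Complex.ofReal_re, Complex.ofReal_im, mul_zero,
    sub_zero]
  exact Real.exp_le_exp.2 (mul_le_mul_of_nonneg_left this (by linarith))

/-- Variation of constants: fixed points built from `volterra` will solve `u' = μ u + f`. -/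
theorem hasDerivAt_volterra {μ : ℂ} (hμ : μ.re ≤ 0) {f : ℝ → ℂ} (hf : Continuous f)
    (hi : ∀ x, IntegrableOn f (Set.Iic x)) (x : ℝ) :
    HasDerivAt (volterra μ f) (μ * volterra μ f x + f x) x := by
  have h1 := hasDerivAt_integral_Iic (f := fun y : ℝ => Complex.exp (-μ * y) * f y)
    (by fun_prop) (integrableOn_exp_mul hμ hi) x
  have h2 : HasDerivAt (fun x : ℝ => Complex.exp (μ * x)) (Complex.exp (μ * x) * (μ * 1)) x :=
    ((Complex.ofRealCLM.hasDerivAt (x := x)).const_mul μ).cexp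
  refine (h2.mul h1).congr_deriv ?_
  rw [volterra, ← mul_assoc (Complex.exp _) (Complex.exp _), ← Complex.exp_add]
  simp only [neg_mul, add_neg_cancel, Complex.exp_zero]
  ring

/-- The kernel satisfies `|e^{μ(x-y)}| ≤ 1` for `y ≤ x`, since `Re μ ≤ 0`. -/
theorem norm_volterra_le {μ : ℂ} (hμ : μ.re ≤ 0) {f : ℝ → ℂ} {g : ℝ → ℝ} {x : ℝ}
    (hg : IntegrableOn g (Set.Iic x)) (hfg : ∀ y, ‖f y‖ ≤ g y) :
    ‖volterra μ f x‖ ≤ ∫ y in Set.Iic x, g y := by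
  rw [volterra, ← integral_const_mul]
  refine norm_integral_le_of_norm_le hg ?_
  filter_upwards [ae_restrict_mem measurableSet_Iic] with y hy
  have hy : y ≤ x := hy
  rw [← mul_assoc, ← Complex.exp_add, norm_mul, Complex.norm_exp]
  refine (mul_le_of_le_one_left (norm_nonneg _) ?_).trans (hfg y)
  rw [Real.exp_le_one_iff]
  simp only [Complex.add_re, Complex.mul_re, Complex.neg_re, Complex.ofReal_re,
    Complex.ofReal_im, mul_zero, sub_zero]
  nlinarith

theorem volterra_sub {μ : ℂ} (hμ : μ.re ≤ 0) {f g : ℝ → ℂ}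
    (hf : ∀ x, IntegrableOn f (Set.Iic x)) (hg : ∀ x, IntegrableOn g (Set.Iic x)) (x : ℝ) :
    volterra μ (fun y => f y - g y) x = volterra μ f x - volterra μ g x := by
  simp only [volterra, mul_sub]
  rw [integral_sub (integrableOn_exp_mul hμ hf x) (integrableOn_exp_mul hμ hg x), mul_sub]

/-! ### A contraction in a weighted sup norm -/

section Weighted

variable {m : ℝ → ℝ}

/-- The weight `exp (2 ∫_{-∞}^x m)`. -/
noncomputable def weight (m : ℝ → ℝ) (x : ℝ) : ℝ := Real.exp (2 * ∫ y in Set.Iic x, m y)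

theorem weight_pos (x : ℝ) : 0 < weight m x := Real.exp_pos _

theorem hasDerivAt_weight (hm : Continuous m) (hi : ∀ x, IntegrableOn m (Set.Iic x)) (x : ℝ) :
    HasDerivAt (weight m) (2 * (weight m x * m x)) x := by
  refine ((hasDerivAt_integral_Iic hm hi x).const_mul 2).exp.congr_deriv ?_
  rw [weight]
  ring

theorem continuous_weight (hm : Continuous m) (hi : ∀ x, IntegrableOn m (Set.Iic x)) :
    Continuous (weight m) :=
  continuous_iff_continuousAt.2 fun x => (hasDerivAt_weight hm hi x).continuousAt

theorem tendsto_weight (hi : ∀ x, IntegrableOn m (Set.Iic x)) :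
    Tendsto (weight m) atBot (𝓝 1) := by
  have h := ((tendsto_integral_Iic_atBot hi).const_mul 2).rexp
  rw [mul_zero, Real.exp_zero] at h
  exact h

theorem integrableOn_weight_mul (hm : Continuous m) (hm0 : ∀ x, 0 ≤ m x)
    (hi : ∀ x, IntegrableOn m (Set.Iic x)) (x : ℝ) :
    IntegrableOn (fun y => weight m y * m y) (Set.Iic x) := by
  refine Integrable.bdd_mul (c := weight m x) (hi x)
    (continuous_weight hm hi).aestronglyMeasurable ?_
  filter_upwards [ae_restrict_mem measurableSet_Iic] with y hy
  have hy : y ≤ x := hy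
  rw [Real.norm_of_nonneg (weight_pos y).le]
  refine Real.exp_le_exp.2 (mul_le_mul_of_nonneg_left ?_ zero_le_two)
  exact setIntegral_mono_set (hi x) (ae_of_all _ hm0) (Set.Iic_subset_Iic.2 hy).eventuallyLE

/-- The weight satisfies `W' = 2 W m` and tends to `1` at `-∞`. The `2` in its exponent produces the
`1/2` here, which becomes the contraction constant however large `∫ m` is. -/
theorem integral_weight_mul (hm : Continuous m) (hm0 : ∀ x, 0 ≤ m x)
    (hi : ∀ x, IntegrableOn m (Set.Iic x)) (x : ℝ) :
    ∫ y in Set.Iic x, weight m y * m y = (weight m x - 1) / 2 := by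
  have h := integral_Iic_of_hasDerivAt_of_tendsto (a := x)
    (continuous_weight hm hi).continuousWithinAt
    (fun y _ => hasDerivAt_weight hm hi y)
    ((integrableOn_weight_mul hm hm0 hi x).const_mul 2) (tendsto_weight hi)
  rw [integral_const_mul] at h
  linarith

theorem norm_volterra_le_weight (hm : Continuous m) (hm0 : ∀ x, 0 ≤ m x)
    (hi : ∀ x, IntegrableOn m (Set.Iic x)) {μ : ℂ} (hμ : μ.re ≤ 0) {f : ℝ → ℂ} {C : ℝ}
    (hf : ∀ y, ‖f y‖ ≤ C * (weight m y * m y)) (x : ℝ) :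
    ‖volterra μ f x‖ ≤ C * ((weight m x - 1) / 2) := by
  rw [← integral_weight_mul hm hm0 hi, ← integral_const_mul]
  exact norm_volterra_le hμ ((integrableOn_weight_mul hm hm0 hi x).const_mul C) hf

theorem integrableOn_of_norm_le_weight (hm : Continuous m) (hm0 : ∀ x, 0 ≤ m x)
    (hi : ∀ x, IntegrableOn m (Set.Iic x)) {f : ℝ → ℂ} (hc : Continuous f) {C : ℝ}
    (hf : ∀ y, ‖f y‖ ≤ C * (weight m y * m y)) (x : ℝ) :
    IntegrableOn f (Set.Iic x) :=
  ((integrableOn_weight_mul hm hm0 hi x).const_mul C).mono' hc.aestronglyMeasurable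
    (ae_of_all _ hf)

theorem norm_weight_mul_comb_le {a b : ℝ → ℂ} (hab : ∀ x, ‖a x‖ + ‖b x‖ ≤ m x) (p : ℂ × ℂ)
    {C : ℝ} (hp : ‖p‖ ≤ C) (y : ℝ) :
    ‖(weight m y : ℂ) * (a y * p.1 + b y * p.2)‖ ≤ C * (weight m y * m y) := by
  have hC : 0 ≤ C := (norm_nonneg _).trans hp
  rw [norm_mul, Complex.norm_of_nonneg (weight_pos y).le, mul_left_comm]
  refine mul_le_mul_of_nonneg_left ?_ (weight_pos y).le
  calc ‖a y * p.1 + b y * p.2‖ ≤ ‖a y‖ * ‖p.1‖ + ‖b y‖ * ‖p.2‖ := by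
        rw [← norm_mul, ← norm_mul]
        exact norm_add_le _ _
    _ ≤ ‖a y‖ * C + ‖b y‖ * C := by
        gcongr
        · exact (norm_fst_le p).trans hp
        · exact (norm_snd_le p).trans hp
    _ ≤ C * m y := by nlinarith [hab y]

/-- Existence, on the whole line, of the solution of a diagonal system with an integrable
perturbation which tends to `(1, 0)` at `-∞`. -/
theorem exists_solution_atBot (hm : Continuous m) (hi : ∀ x, IntegrableOn m (Set.Iic x))
    {a b c d : ℝ → ℂ} (ha : Continuous a) (hb : Continuous b) (hc : Continuous c)
    (hd : Continuous d) (hab : ∀ x, ‖a x‖ + ‖b x‖ ≤ m x) (hcd : ∀ x, ‖c x‖ + ‖d x‖ ≤ m x)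
    {μ : ℂ} (hμ : μ.re ≤ 0) :
    ∃ u w : ℝ → ℂ, (∀ x, HasDerivAt u (a x * u x + b x * w x) x) ∧
      (∀ x, HasDerivAt w (μ * w x + (c x * u x + d x * w x)) x) ∧
      Tendsto u atBot (𝓝 1) ∧ Tendsto w atBot (𝓝 0) := by
  have hm0 : ∀ x, 0 ≤ m x := fun x => (by positivity : 0 ≤ ‖a x‖ + ‖b x‖).trans (hab x)
  have hW := continuous_weight hm hi
  have hWC : Continuous fun x => (weight m x : ℂ) := Complex.continuous_ofReal.comp hW
  have hW0 : ∀ x, (weight m x : ℂ) ≠ 0 := fun x => Complex.ofReal_ne_zero.2 (weight_pos x).ne'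
  have hW1 : ∀ x, 1 ≤ weight m x := fun x => Real.one_le_exp
    (mul_nonneg zero_le_two (integral_nonneg hm0))
  have h0 : (0 : ℂ).re ≤ 0 := le_rfl
  -- The unknown pair is written as `W g` with `g` bounded, so that the plain sup norm of `g` is the
  -- weighted norm of the pair.
  let F (a b : ℝ → ℂ) (g : BoundedContinuousFunction ℝ (ℂ × ℂ)) (y : ℝ) : ℂ :=
    (weight m y : ℂ) * (a y * (g y).1 + b y * (g y).2)
  have Fcont : ∀ a b : ℝ → ℂ, Continuous a → Continuous b → ∀ g, Continuous (F a b g) := by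
    intro a b ha hb g
    have := g.continuous
    fun_prop
  have Fle : ∀ a b : ℝ → ℂ, (∀ x, ‖a x‖ + ‖b x‖ ≤ m x) → ∀ g y,
      ‖F a b g y‖ ≤ ‖g‖ * (weight m y * m y) := fun a b h g y =>
    norm_weight_mul_comb_le h (g y) (g.norm_coe_le_norm y) y
  have Fint : ∀ a b : ℝ → ℂ, Continuous a → Continuous b → (∀ x, ‖a x‖ + ‖b x‖ ≤ m x) →
      ∀ g x, IntegrableOn (F a b g) (Set.Iic x) := fun a b ha hb h g =>
    integrableOn_of_norm_le_weight hm hm0 hi (Fcont a b ha hb g) (Fle a b h g)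
  have Vcont : ∀ μ : ℂ, μ.re ≤ 0 → ∀ a b : ℝ → ℂ, Continuous a → Continuous b →
      (∀ x, ‖a x‖ + ‖b x‖ ≤ m x) → ∀ g, Continuous (volterra μ (F a b g)) :=
    fun μ hμ a b ha hb h g => continuous_iff_continuousAt.2 fun x =>
      (hasDerivAt_volterra hμ (Fcont a b ha hb g) (Fint a b ha hb h g) x).continuousAt
  -- Dividing by the weight gives `(W - 1)/(2W) ≤ 1/2`.
  have half : ∀ (C x : ℝ) (v : ℂ), 0 ≤ C → ‖v‖ ≤ C * ((weight m x - 1) / 2) →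
      ‖(weight m x : ℂ)⁻¹ * v‖ ≤ C / 2 := by
    intro C x v hC hv
    have hw := weight_pos (m := m) x
    rw [norm_mul, norm_inv, Complex.norm_of_nonneg hw.le, inv_mul_le_iff₀ hw]
    nlinarith
  -- The Volterra equation for the pair, divided by the weight; the constant `1` prescribes the
  -- limit `(1, 0)` at `-∞`.
  let T (g : BoundedContinuousFunction ℝ (ℂ × ℂ)) : BoundedContinuousFunction ℝ (ℂ × ℂ) :=
    BoundedContinuousFunction.ofNormedAddCommGroup
      (fun x => ((weight m x : ℂ)⁻¹ * (1 + volterra 0 (F a b g) x),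
        (weight m x : ℂ)⁻¹ * volterra μ (F c d g) x))
      (((hWC.inv₀ hW0).mul (continuous_const.add (Vcont 0 h0 a b ha hb hab g))).prodMk
        ((hWC.inv₀ hW0).mul (Vcont μ hμ c d hc hd hcd g))) (1 + ‖g‖ / 2) (by
      intro x
      refine norm_prod_le_iff.2 ⟨?_, ?_⟩
      · rw [mul_add]
        refine (norm_add_le _ _).trans (add_le_add ?_ (half _ x _ (norm_nonneg g)
          (norm_volterra_le_weight hm hm0 hi h0 (Fle a b hab g) x)))
        rw [mul_one, norm_inv, Complex.norm_of_nonneg (weight_pos x).le]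
        exact inv_le_one_of_one_le₀ (hW1 x)
      · exact (half _ x _ (norm_nonneg g)
          (norm_volterra_le_weight hm hm0 hi hμ (Fle c d hcd g) x)).trans (by linarith))
  have diff : ∀ μ : ℂ, μ.re ≤ 0 → ∀ a b : ℝ → ℂ, Continuous a → Continuous b →
      (∀ x, ‖a x‖ + ‖b x‖ ≤ m x) → ∀ g h x,
      ‖(weight m x : ℂ)⁻¹ * (volterra μ (F a b g) x - volterra μ (F a b h) x)‖
        ≤ ‖g - h‖ / 2 := by
    intro μ hμ a b ha hb hab g h x
    refine half _ x _ (norm_nonneg _) ?_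
    rw [← volterra_sub hμ (Fint a b ha hb hab g) (Fint a b ha hb hab h)]
    have : (fun y => F a b g y - F a b h y) = F a b (g - h) := by
      funext y
      simp only [F, BoundedContinuousFunction.coe_sub, Pi.sub_apply, Prod.fst_sub, Prod.snd_sub]
      ring
    rw [this]
    exact norm_volterra_le_weight hm hm0 hi hμ (Fle a b hab _) x
  have hT : ContractingWith (1 / 2) T := by
    refine ⟨by rw [← NNReal.coe_lt_coe]; norm_num, LipschitzWith.of_dist_le_mul fun g h => ?_⟩
    rw [dist_eq_norm, dist_eq_norm]
    refine (BoundedContinuousFunction.norm_le (by positivity)).2 fun x => ?_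
    have e1 : ((1 / 2 : NNReal) : ℝ) * ‖g - h‖ = ‖g - h‖ / 2 := by
      push_cast
      ring
    rw [e1]
    refine norm_prod_le_iff.2 ⟨?_, ?_⟩
    · refine le_trans (le_of_eq ?_) (diff 0 h0 a b ha hb hab g h x)
      simp only [T, BoundedContinuousFunction.coe_sub, Pi.sub_apply, Prod.fst_sub,
        BoundedContinuousFunction.coe_ofNormedAddCommGroup]
      congr 1
      ring
    · refine le_trans (le_of_eq ?_) (diff μ hμ c d hc hd hcd g h x)
      simp only [T, BoundedContinuousFunction.coe_sub, Pi.sub_apply, Prod.snd_sub,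
        BoundedContinuousFunction.coe_ofNormedAddCommGroup]
      congr 1
      ring
  obtain ⟨g, hg⟩ : ∃ g, T g = g := ⟨_, hT.fixedPoint_isFixedPt⟩
  have hu : ∀ x, (weight m x : ℂ) * (g x).1 = 1 + volterra 0 (F a b g) x := by
    intro x
    have : (g x).1 = (weight m x : ℂ)⁻¹ * (1 + volterra 0 (F a b g) x) := by
      conv_lhs => rw [← hg]
      rfl
    rw [this, mul_inv_cancel_left₀ (hW0 x)]
  have hw : ∀ x, (weight m x : ℂ) * (g x).2 = volterra μ (F c d g) x := by
    intro x
    have : (g x).2 = (weight m x : ℂ)⁻¹ * volterra μ (F c d g) x := by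
      conv_lhs => rw [← hg]
      rfl
    rw [this, mul_inv_cancel_left₀ (hW0 x)]
  have lim : ∀ μ : ℂ, μ.re ≤ 0 → ∀ a b : ℝ → ℂ, (∀ x, ‖a x‖ + ‖b x‖ ≤ m x) →
      Tendsto (volterra μ (F a b g)) atBot (𝓝 0) := by
    intro μ hμ a b hab
    refine squeeze_zero_norm (norm_volterra_le_weight hm hm0 hi hμ (Fle a b hab g)) ?_
    have := (((tendsto_weight hi).sub_const 1).div_const 2).const_mul ‖g‖
    simpa using this
  refine ⟨fun x => 1 + volterra 0 (F a b g) x, volterra μ (F c d g), fun x => ?_, fun x => ?_,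
    ?_, lim μ hμ c d hcd⟩
  · refine ((hasDerivAt_volterra h0 (Fcont a b ha hb g) (Fint a b ha hb hab g) x).const_add
      1).congr_deriv ?_
    simp only [← hu, ← hw, F]
    ring
  · refine (hasDerivAt_volterra hμ (Fcont c d hc hd g) (Fint c d hc hd hcd g) x).congr_deriv ?_
    simp only [← hu, ← hw, F]
    ring
  · simpa using (lim 0 h0 a b hab).const_add 1

end Weighted

/-! ### The spectral plane -/

/-- The closed region `Im λ ≥ 0`, without `0` and the branch points. -/
def upper (q0 : ℝ) : Set ℂ := {z | z ≠ 0 ∧ z ^ 2 + (q0 : ℂ) ^ 2 ≠ 0 ∧ 0 ≤ (‖z‖ ^ 2 - q0 ^ 2) * z.im}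

theorem sq_add_sq_eq_zero_iff (q0 : ℝ) (z : ℂ) :
    z ^ 2 + (q0 : ℂ) ^ 2 = 0 ↔ z = Complex.I * q0 ∨ z = -(Complex.I * q0) := by
  have h : z ^ 2 + (q0 : ℂ) ^ 2 = (z - Complex.I * q0) * (z + Complex.I * q0) := by
    linear_combination (q0 : ℂ) ^ 2 * Complex.I_sq
  rw [h, mul_eq_zero, sub_eq_zero, add_eq_zero_iff_eq_neg]

theorem mem_contSpec0_iff {q0 : ℝ} (hq0 : 0 < q0) (z : ℂ) :
    z ∈ contSpec0 q0 ↔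
      z ≠ 0 ∧ z ^ 2 + (q0 : ℂ) ^ 2 ≠ 0 ∧ (‖z‖ ^ 2 - q0 ^ 2) * z.im = 0 := by
  have h : (‖z‖ ^ 2 - q0 ^ 2) * z.im = 0 ↔ z.im = 0 ∨ ‖z‖ = q0 := by
    rw [mul_eq_zero, sub_eq_zero, sq_eq_sq₀ (norm_nonneg z) hq0.le, or_comm]
  rw [h, ne_eq (z ^ 2 + _), sq_add_sq_eq_zero_iff]
  simp only [contSpec0, contSpec, Set.mem_sdiff, Set.mem_ofPred_eq, Set.mem_insert_iff,
    Set.mem_singleton_iff]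
  tauto

theorem ne_of_side_ne_zero {q0 : ℝ} (hq0 : 0 < q0) {z : ℂ}
    (hz : (‖z‖ ^ 2 - q0 ^ 2) * z.im ≠ 0) : z ≠ 0 ∧ z ^ 2 + (q0 : ℂ) ^ 2 ≠ 0 := by
  refine ⟨fun h => hz (by simp [h]), fun h => hz ?_⟩
  have : ‖z‖ = q0 := by
    rcases (sq_add_sq_eq_zero_iff q0 z).1 h with h | h <;> simp [h, abs_of_pos hq0]
  rw [this, sub_self, zero_mul]

theorem Dplus_union_contSpec0 {q0 : ℝ} (hq0 : 0 < q0) : Dplus q0 ∪ contSpec0 q0 = upper q0 := by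
  ext z
  simp only [Set.mem_union, mem_contSpec0_iff hq0, Dplus, upper, Set.mem_ofPred_eq]
  constructor
  · rintro (h | ⟨h1, h2, h3⟩)
    · exact ⟨(ne_of_side_ne_zero hq0 h.ne').1, (ne_of_side_ne_zero hq0 h.ne').2, h.le⟩
    · exact ⟨h1, h2, h3.ge⟩
  · rintro ⟨h1, h2, h3⟩
    rcases h3.lt_or_eq with h | h
    · exact Or.inl h
    · exact Or.inr ⟨h1, h2, h.symm⟩

theorem neg_mem_upper_iff {q0 : ℝ} {z : ℂ} : -z ∈ upper q0 ↔ starRingEnd ℂ z ∈ upper q0 := by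
  have h : (starRingEnd ℂ z) ^ 2 + (q0 : ℂ) ^ 2 = starRingEnd ℂ (z ^ 2 + (q0 : ℂ) ^ 2) := by
    simp
  simp only [upper, Set.mem_ofPred_eq, h, ne_eq, map_eq_zero, neg_eq_zero, neg_sq, norm_neg,
    RCLike.norm_conj, Complex.neg_im, Complex.conj_im]

/-- The closed region `Im λ ≤ 0` is handled throughout as `-z ∈ upper q0`, since `λ` is odd. -/
theorem Dminus_union_contSpec0 {q0 : ℝ} (hq0 : 0 < q0) :
    Dminus q0 ∪ contSpec0 q0 = {z | -z ∈ upper q0} := by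
  ext z
  rw [Set.mem_ofPred_eq, ← Dplus_union_contSpec0 hq0]
  simp only [Set.mem_union, mem_contSpec0_iff hq0, Dplus, Dminus, Set.mem_ofPred_eq,
    neg_eq_zero, neg_sq, norm_neg, Complex.neg_im, mul_neg, ne_eq, Left.neg_pos_iff]

theorem contSpec0_subset_upper {q0 : ℝ} (hq0 : 0 < q0) {z : ℂ} (hz : z ∈ contSpec0 q0) :
    z ∈ upper q0 ∧ -z ∈ upper q0 := by
  constructor
  · rw [← Dplus_union_contSpec0 hq0]
    exact Or.inr hz
  · have : z ∈ Dminus q0 ∪ contSpec0 q0 := Or.inr hz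
    rwa [Dminus_union_contSpec0 hq0] at this

/-- From `1/z = z*/|z|²`. This is why the sign condition defining `D±` is the sign of `Im λ`. -/
theorem lam_im {q0 : ℝ} {z : ℂ} (hz : z ≠ 0) :
    2 * ‖z‖ ^ 2 * (lam q0 z).im = (‖z‖ ^ 2 - q0 ^ 2) * z.im := by
  have h : z + (q0 : ℂ) ^ 2 / z = z + ((q0 ^ 2 / ‖z‖ ^ 2 : ℝ) : ℂ) * starRingEnd ℂ z := by
    have hn : (‖z‖ : ℂ) ≠ 0 := by simpa using hz
    have := Complex.mul_conj' z
    push_cast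
    field_simp
    linear_combination (-(q0 : ℂ) ^ 2) * this
  have hn : ‖z‖ ≠ 0 := by simpa using hz
  have h2 : (lam q0 z).im = (z.im - q0 ^ 2 / ‖z‖ ^ 2 * z.im) / 2 := by
    rw [lam, h, ← Complex.ofReal_ofNat, Complex.div_ofReal_im, Complex.add_im,
      Complex.im_ofReal_mul, Complex.conj_im]
    ring
  rw [h2]
  field_simp

theorem lam_im_nonneg {q0 : ℝ} {z : ℂ} (hz : z ∈ upper q0) : 0 ≤ (lam q0 z).im := by
  have hn : 0 < ‖z‖ := norm_pos_iff.2 hz.1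
  have h := lam_im (q0 := q0) hz.1
  have h3 := hz.2.2
  rw [← h] at h3
  exact nonneg_of_mul_nonneg_right h3 (by positivity)

theorem lam_im_pos {q0 : ℝ} (hq0 : 0 < q0) {z : ℂ} (hz : z ∈ Dplus q0) : 0 < (lam q0 z).im := by
  have h0 := (ne_of_side_ne_zero hq0 (ne_of_gt hz)).1
  have hn : 0 < ‖z‖ := norm_pos_iff.2 h0
  have h := lam_im (q0 := q0) h0
  have h3 : 0 < (‖z‖ ^ 2 - q0 ^ 2) * z.im := hz
  rw [← h] at h3
  exact pos_of_mul_pos_right h3 (by positivity)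

theorem gam_ne_zero {q0 : ℝ} {z : ℂ} (hz : z ≠ 0) (hz' : z ^ 2 + (q0 : ℂ) ^ 2 ≠ 0) :
    gam q0 z ≠ 0 := by
  have h : gam q0 z = (z ^ 2 + (q0 : ℂ) ^ 2) / z ^ 2 := by
    rw [gam]
    field_simp
  rw [h]
  exact div_ne_zero hz' (pow_ne_zero 2 hz)

theorem lam_conj (q0 : ℝ) (z : ℂ) : lam q0 (starRingEnd ℂ z) = starRingEnd ℂ (lam q0 z) := by
  simp only [lam, map_div₀, map_add, map_pow, Complex.conj_ofReal, Complex.conj_ofNat]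

theorem kk_conj (q0 : ℝ) (z : ℂ) : kk q0 (starRingEnd ℂ z) = starRingEnd ℂ (kk q0 z) := by
  simp only [kk, map_div₀, map_sub, map_pow, Complex.conj_ofReal, Complex.conj_ofNat]

theorem gam_conj (q0 : ℝ) (z : ℂ) : gam q0 (starRingEnd ℂ z) = starRingEnd ℂ (gam q0 z) := by
  simp [gam]

theorem theta_conj (q0 τ x t : ℝ) (z : ℂ) :
    theta q0 τ x t (starRingEnd ℂ z) = starRingEnd ℂ (theta q0 τ x t z) := by
  have h2 : starRingEnd ℂ (2 : ℂ) = 2 := Complex.conj_ofNat 2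
  have h4 : starRingEnd ℂ (4 : ℂ) = 4 := Complex.conj_ofNat 4
  have h8 : starRingEnd ℂ (8 : ℂ) = 8 := Complex.conj_ofNat 8
  simp only [theta, lam_conj, kk_conj, map_mul, map_add, map_neg, map_pow, Complex.conj_ofReal,
    h2, h4, h8]

theorem lam_neg (q0 : ℝ) (z : ℂ) : lam q0 (-z) = -lam q0 z := by
  simp only [lam, div_neg]
  ring

theorem kk_neg (q0 : ℝ) (z : ℂ) : kk q0 (-z) = -kk q0 z := by
  simp only [kk, div_neg]
  ring

theorem theta_neg (q0 τ x t : ℝ) (z : ℂ) : theta q0 τ x t (-z) = theta q0 τ (-x) t z := by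
  simp only [theta, lam_neg, kk_neg, Complex.ofReal_neg]
  ring

theorem lam_inv {q0 : ℝ} (hq0 : 0 < q0) {z : ℂ} (hz : z ≠ 0) :
    lam q0 (-(q0 : ℂ) ^ 2 / z) = -lam q0 z := by
  have : (q0 : ℂ) ≠ 0 := Complex.ofReal_ne_zero.2 hq0.ne'
  simp only [lam]
  field_simp
  ring

theorem kk_inv {q0 : ℝ} (hq0 : 0 < q0) {z : ℂ} (hz : z ≠ 0) :
    kk q0 (-(q0 : ℂ) ^ 2 / z) = kk q0 z := by
  have : (q0 : ℂ) ≠ 0 := Complex.ofReal_ne_zero.2 hq0.ne'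
  simp only [kk]
  field_simp
  ring

theorem theta_inv {q0 : ℝ} (hq0 : 0 < q0) (τ x t : ℝ) {z : ℂ} (hz : z ≠ 0) :
    theta q0 τ x t (-(q0 : ℂ) ^ 2 / z) = -theta q0 τ x t z := by
  simp only [theta, lam_inv hq0 hz, kk_inv hq0 hz]
  ring

theorem gam_inv {q0 : ℝ} (hq0 : 0 < q0) {z : ℂ} (hz : z ≠ 0) :
    gam q0 (-(q0 : ℂ) ^ 2 / z) = z ^ 2 / (q0 : ℂ) ^ 2 * gam q0 z := by
  have : (q0 : ℂ) ≠ 0 := Complex.ofReal_ne_zero.2 hq0.ne'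
  simp only [gam]
  field_simp
  ring

/-! ### Solutions of the scattering problem -/

section Solutions

variable {q : ℝ → ℝ → ℂ} {q0 τ t : ℝ} {z w : ℂ} {F : Filter ℝ} {u v : ℝ → Fin 2 → ℂ}

theorem Xmat_mulVec (k p : ℂ) (v : Fin 2 → ℂ) :
    (Xmat k p).mulVec v = ![-(Complex.I * k) * v 0 + p * v 1,
      -(starRingEnd ℂ p) * v 0 + Complex.I * k * v 1] := by
  ext i
  fin_cases i <;> simp [Xmat, sigma3, Qmat, Matrix.mulVec, dotProduct, Fin.sum_univ_two]

theorem isScatteringSolution_iff : IsScatteringSolution q q0 t z v ↔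
    (∀ x, HasDerivAt (fun x => v x 0)
      (-(Complex.I * kk q0 z) * v x 0 + q x t * v x 1) x) ∧
    ∀ x, HasDerivAt (fun x => v x 1)
      (-(starRingEnd ℂ (q x t)) * v x 0 + Complex.I * kk q0 z * v x 1) x := by
  simp only [IsScatteringSolution, hasDerivAt_pi, Fin.forall_fin_two, Xmat_mulVec, forall_and,
    Matrix.cons_val_zero, Matrix.cons_val_one]

theorem IsScatteringSolution.continuous (hv : IsScatteringSolution q q0 t z v) :
    Continuous v :=
  continuous_iff_continuousAt.2 fun x => (hv x).continuousAt

theorem IsScatteringSolution.const_smul (hv : IsScatteringSolution q q0 t z v) (c : ℂ) :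
    IsScatteringSolution q q0 t z (c • v) := fun x =>
  ((hv x).const_smul c).congr_deriv (by rw [Pi.smul_apply, Matrix.mulVec_smul])

theorem IsScatteringSolution.add (hu : IsScatteringSolution q q0 t z u)
    (hv : IsScatteringSolution q q0 t z v) : IsScatteringSolution q q0 t z (u + v) := fun x =>
  ((hu x).add (hv x)).congr_deriv (by rw [Pi.add_apply, Matrix.mulVec_add])

theorem isScatteringSolution_zero : IsScatteringSolution q q0 t z 0 := fun x => by
  simp

/-- Abel's identity: the coefficient matrix has trace zero. -/
theorem IsScatteringSolution.wr_eq (hu : IsScatteringSolution q q0 t z u)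
    (hv : IsScatteringSolution q q0 t z v) (x y : ℝ) : wr (u x) (v x) = wr (u y) (v y) := by
  rw [isScatteringSolution_iff] at hu hv
  have h : ∀ x, HasDerivAt (fun x => wr (u x) (v x)) 0 x := fun x =>
    (((hu.1 x).mul (hv.2 x)).sub ((hu.2 x).mul (hv.1 x))).congr_deriv (by ring)
  exact is_const_of_deriv_eq_zero (fun x => (h x).differentiableAt) (fun x => (h x).deriv) x y

/-- A bounded potential makes the vector field Lipschitz uniformly in `x`, so uniqueness is global.
-/
theorem IsScatteringSolution.eq_of_eq (hb : ∃ C, ∀ x, ‖q x t‖ ≤ C)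
    (hu : IsScatteringSolution q q0 t z u) (hv : IsScatteringSolution q q0 t z v) {x : ℝ}
    (h : u x = v x) : u = v := by
  obtain ⟨C, hC⟩ := hb
  have hC0 : 0 ≤ C := (norm_nonneg _).trans (hC 0)
  refine ODE_solution_unique_univ (s := fun _ => Set.univ)
    (v := fun x p => (Xmat (kk q0 z) (q x t)).mulVec p) (K := Real.toNNReal (‖kk q0 z‖ + C))
    (fun x => (LipschitzWith.of_dist_le_mul fun a b => ?_).lipschitzOnWith)
    (fun x => ⟨hu x, trivial⟩) (fun x => ⟨hv x, trivial⟩) h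
  rw [dist_eq_norm, dist_eq_norm, ← Matrix.mulVec_sub, Xmat_mulVec,
    Real.coe_toNNReal _ (by positivity)]
  have h0 := norm_le_pi_norm (a - b) 0
  have h1 := norm_le_pi_norm (a - b) 1
  have hx := hC x
  refine (pi_norm_le_iff_of_nonneg (by positivity)).2 (Fin.forall_fin_two.2 ⟨?_, ?_⟩)
  · refine (norm_add_le _ _).trans ?_
    rw [norm_mul, norm_mul, norm_neg, norm_mul, Complex.norm_I, one_mul, add_mul]
    gcongr
  · refine (norm_add_le _ _).trans ?_
    rw [norm_mul, norm_mul, norm_neg, norm_mul, Complex.norm_I, one_mul, add_mul, add_comm,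
      RCLike.norm_conj]
    gcongr

/-- Two vectors with vanishing Wronskian are proportional. -/
theorem exists_eq_smul_of_wr_eq_zero {a b : Fin 2 → ℂ} (h : wr a b = 0) (hb : b ≠ 0) :
    ∃ c : ℂ, a = c • b := by
  rw [wr] at h
  by_cases h0 : b 0 = 0
  · have h1 : b 1 ≠ 0 := fun h1 => hb (by ext i; fin_cases i <;> simp [h0, h1])
    have ha : a 0 = 0 := by simpa [h0, h1] using h
    refine ⟨a 1 / b 1, ?_⟩
    ext i
    fin_cases i <;> simp [ha, h0, h1]
  · refine ⟨a 0 / b 0, ?_⟩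
    ext i
    fin_cases i
    · simp [h0]
    · simp only [Fin.mk_one, Pi.smul_apply, smul_eq_mul]
      field_simp
      linear_combination -h

theorem IsScatteringSolution.eq_smul_of_wr_eq_zero (hb : ∃ C, ∀ x, ‖q x t‖ ≤ C)
    (hu : IsScatteringSolution q q0 t z u) (hv : IsScatteringSolution q q0 t z v) (hv0 : v ≠ 0)
    (h : wr (u 0) (v 0) = 0) : ∃ c : ℂ, u = c • v := by
  obtain ⟨c, hc⟩ := exists_eq_smul_of_wr_eq_zero h
    (fun h0 => hv0 (hv.eq_of_eq hb isScatteringSolution_zero (x := 0) h0))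
  exact ⟨c, hu.eq_of_eq hb (hv.const_smul c) hc⟩

theorem sigma3_mul_Qmat (w : ℂ) : sigma3 * Qmat w = !![0, w; starRingEnd ℂ w, 0] := by
  simp [sigma3, Qmat]

theorem Ymat_eq (w z : ℂ) : Ymat w z =
    !![1, -(Complex.I / z) * w; -(Complex.I / z) * starRingEnd ℂ w, 1] := by
  rw [Ymat, sigma3_mul_Qmat]
  ext i j
  fin_cases i <;> fin_cases j <;> simp

theorem isJostColumn_zero_iff : IsJostColumn F w q q0 τ t z 0 v ↔
    IsScatteringSolution q q0 t z v ∧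
    Tendsto (fun x => Complex.exp (Complex.I * theta q0 τ x t z) * v x 0) F (𝓝 1) ∧
    Tendsto (fun x => Complex.exp (Complex.I * theta q0 τ x t z) * v x 1) F
      (𝓝 (-(Complex.I / z) * starRingEnd ℂ w)) := by
  simp [IsJostColumn, tendsto_pi_nhds, Ymat_eq, sigma3]

theorem isJostColumn_one_iff : IsJostColumn F w q q0 τ t z 1 v ↔
    IsScatteringSolution q q0 t z v ∧
    Tendsto (fun x => Complex.exp (-(Complex.I * theta q0 τ x t z)) * v x 0) F
      (𝓝 (-(Complex.I / z) * w)) ∧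
    Tendsto (fun x => Complex.exp (-(Complex.I * theta q0 τ x t z)) * v x 1) F (𝓝 1) := by
  simp [IsJostColumn, tendsto_pi_nhds, Ymat_eq, sigma3]

theorem IsJostColumn.ne_zero [F.NeBot] {j : Fin 2} (hv : IsJostColumn F w q q0 τ t z j v) :
    v ≠ 0 := by
  rintro rfl
  have h := tendsto_pi_nhds.1 hv.2 j
  simp only [Pi.zero_apply, smul_zero] at h
  have h2 := tendsto_nhds_unique h tendsto_const_nhds
  fin_cases j <;> simp [Ymat_eq] at h2

theorem hasDerivAt_theta (x : ℝ) :
    HasDerivAt (fun x : ℝ => theta q0 τ x t z) (lam q0 z) x := by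
  have h : HasDerivAt (fun x : ℝ => (x : ℂ)) 1 x := Complex.ofRealCLM.hasDerivAt
  exact ((h.add_const ((-8 * (τ : ℂ) * kk q0 z ^ 3 + 2 * kk q0 z
    + 4 * (τ : ℂ) * kk q0 z * (q0 : ℂ) ^ 2) * (t : ℂ))).const_mul (lam q0 z)).congr_deriv
    (mul_one _)

theorem theta_eq (x : ℝ) : theta q0 τ x t z = lam q0 z * x + theta q0 τ 0 t z := by
  simp only [theta, Complex.ofReal_zero]
  ring

theorem norm_exp_theta (x : ℝ) : ‖Complex.exp (Complex.I * theta q0 τ x t z)‖ =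
    Real.exp (-((lam q0 z).im * x)) * ‖Complex.exp (Complex.I * theta q0 τ 0 t z)‖ := by
  rw [theta_eq, mul_add, Complex.exp_add, norm_mul, Complex.norm_exp]
  simp

/-- Both candidates have the same normalised limit, so `e^{2iθ} Wr(u, v) → 0`. As `x → -∞` the
factor `e^{2iθ}` stays away from zero because `Im λ ≥ 0`, so the constant Wronskian vanishes. Thus
`u = c v`, and the first component, with limit `1`, forces `c = 1`. -/
theorem IsJostColumn.eq_atBot (hb : ∃ C, ∀ x, ‖q x t‖ ≤ C) (hz : z ∈ upper q0)
    (hu : IsJostColumn atBot w q q0 τ t z 0 u) (hv : IsJostColumn atBot w q q0 τ t z 0 v) :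
    u = v := by
  have hv0 := hv.ne_zero
  rw [isJostColumn_zero_iff] at hu hv
  obtain ⟨hu, hu0, hu1⟩ := hu
  obtain ⟨hv, hv0', hv1⟩ := hv
  have hlim := (hu0.mul hv1).sub (hu1.mul hv0')
  have hwr : wr (u 0) (v 0) = 0 := by
    rw [one_mul, mul_one, sub_self] at hlim
    have hE : ∀ᶠ x : ℝ in atBot, ‖Complex.exp (Complex.I * theta q0 τ 0 t z)‖ ^ 2
        * ‖wr (u 0) (v 0)‖ ≤ ‖Complex.exp (Complex.I * theta q0 τ x t z) * u x 0 *
          (Complex.exp (Complex.I * theta q0 τ x t z) * v x 1) -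
          Complex.exp (Complex.I * theta q0 τ x t z) * u x 1 *
          (Complex.exp (Complex.I * theta q0 τ x t z) * v x 0)‖ := by
      filter_upwards [eventually_le_atBot 0] with x hx
      have e : Complex.exp (Complex.I * theta q0 τ x t z) * u x 0 *
          (Complex.exp (Complex.I * theta q0 τ x t z) * v x 1) -
          Complex.exp (Complex.I * theta q0 τ x t z) * u x 1 *
          (Complex.exp (Complex.I * theta q0 τ x t z) * v x 0)
          = Complex.exp (Complex.I * theta q0 τ x t z) ^ 2 * wr (u x) (v x) := by
        rw [wr]
        ring
      rw [e, norm_mul, norm_pow, hu.wr_eq hv 0 x, norm_exp_theta x]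
      gcongr
      refine le_mul_of_one_le_left (norm_nonneg _) (Real.one_le_exp ?_)
      nlinarith [lam_im_nonneg hz]
    have h0 : ‖Complex.exp (Complex.I * theta q0 τ 0 t z)‖ ^ 2 * ‖wr (u 0) (v 0)‖ ≤ 0 := by
      have := hlim.norm
      rw [norm_zero] at this
      exact ge_of_tendsto this hE
    have hpos : 0 < ‖Complex.exp (Complex.I * theta q0 τ 0 t z)‖ ^ 2 :=
      pow_pos (norm_pos_iff.2 (Complex.exp_ne_zero _)) 2
    exact norm_eq_zero.1 (le_antisymm (by nlinarith [norm_nonneg (wr (u 0) (v 0))])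
      (norm_nonneg _))
  obtain ⟨c, rfl⟩ := hu.eq_smul_of_wr_eq_zero hb hv hv0 hwr
  have hc := hv0'.const_mul c
  have hc1 : c * 1 = 1 := by
    refine tendsto_nhds_unique hc (hu0.congr fun x => ?_)
    simp only [Pi.smul_apply, smul_eq_mul]
    ring
  rw [mul_one] at hc1
  rw [hc1, one_smul]

theorem IsJostColumn.exists_atBot (hw : ‖w‖ = q0) (hc : Continuous fun x => q x t)
    (hi : IntegrableOn (fun x => q x t - w) (Set.Iic 0)) (hz : z ∈ upper q0) :
    ∃ v, IsJostColumn atBot w q q0 τ t z 0 v := by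
  obtain ⟨hz0, hz1, -⟩ := id hz
  have hww : w * starRingEnd ℂ w = (q0 : ℂ) ^ 2 := by rw [Complex.mul_conj', hw]
  -- The columns of `Y` are `(1, β)` and `(α, 1)`. Below, `1 - αβ = det Y = γ`; `e1`, `e3` say that
  -- the first is an eigenvector of the limiting matrix for `-iλ`, and `e2`, `e4` that the second is
  -- one for `iλ`.
  obtain ⟨α, hα⟩ : ∃ α, α = -(Complex.I / z) * w := ⟨_, rfl⟩
  obtain ⟨β, hβ⟩ : ∃ β, β = -(Complex.I / z) * starRingEnd ℂ w := ⟨_, rfl⟩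
  have hγ : 1 - α * β ≠ 0 := by
    have : 1 - α * β = gam q0 z := by
      rw [hα, hβ, gam, ← hww]
      field_simp
      linear_combination (- w * starRingEnd ℂ w) * Complex.I_sq
    rw [this]
    exact gam_ne_zero hz0 hz1
  have hγ' : 1 - β * α ≠ 0 := mul_comm α β ▸ hγ
  have e1 : -(Complex.I * kk q0 z) + w * β = -(Complex.I * lam q0 z) := by
    rw [hβ, lam, kk, ← hww]
    field_simp
    ring
  have e2 : -(Complex.I * kk q0 z) * α + w = Complex.I * lam q0 z * α := by
    rw [hα, lam, kk, ← hww]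
    field_simp
    linear_combination (2 * z ^ 2 * w) * Complex.I_sq
  have e3 : -starRingEnd ℂ w + Complex.I * kk q0 z * β = -(Complex.I * lam q0 z) * β := by
    rw [hβ, lam, kk, ← hww]
    field_simp
    linear_combination (-2 * z ^ 2 * starRingEnd ℂ w) * Complex.I_sq
  have e4 : -starRingEnd ℂ w * α + Complex.I * kk q0 z = Complex.I * lam q0 z := by
    rw [hα, lam, kk, ← hww]
    field_simp
    ring
  obtain ⟨δ, hδ⟩ : ∃ δ : ℝ → ℂ, δ = fun x => q x t - w := ⟨_, rfl⟩
  have hδc : Continuous δ := hδ ▸ hc.sub continuous_const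
  have hδs : Continuous fun x => starRingEnd ℂ (δ x) := Complex.continuous_conj.comp hδc
  have hδi : ∀ x, IntegrableOn δ (Set.Iic x) := by
    intro x
    rw [← hδ] at hi
    refine (hi.union (hδc.integrableOn_Icc (a := 0) (b := x))).mono_set fun y hy => ?_
    rcases le_total y 0 with h | h
    · exact Or.inl h
    · exact Or.inr ⟨h, hy⟩
  let K := (1 + ‖α‖ + ‖β‖ + ‖α‖ ^ 2 + ‖β‖ ^ 2) / ‖1 - α * β‖
  have bound : ∀ p r p' r' : ℂ, ‖p‖ + ‖r‖ + ‖p'‖ + ‖r'‖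
      ≤ 1 + ‖α‖ + ‖β‖ + ‖α‖ ^ 2 + ‖β‖ ^ 2 → ∀ x : ℝ,
      ‖(p * δ x + r * starRingEnd ℂ (δ x)) / (1 - α * β)‖
        + ‖(p' * δ x + r' * starRingEnd ℂ (δ x)) / (1 - α * β)‖ ≤ K * ‖δ x‖ := by
    intro p r p' r' h x
    have h1 : ∀ p r : ℂ, ‖p * δ x + r * starRingEnd ℂ (δ x)‖ ≤ (‖p‖ + ‖r‖) * ‖δ x‖ := by
      intro p r
      refine (norm_add_le _ _).trans (le_of_eq ?_)
      rw [norm_mul, norm_mul, RCLike.norm_conj, add_mul]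
    have h2 := h1 p r
    have h3 := h1 p' r'
    rw [norm_div, norm_div, ← add_div, div_mul_eq_mul_div]
    gcongr
    nlinarith [norm_nonneg (δ x)]
  -- The coefficients are the entries of `Y⁻¹ (Q - Q_w) Y`, where `Q_w` is `Qmat w`, and `μ = 2iλ`
  -- is the difference of the eigenvalues. The factors `1` and `-1` are kept so that `bound` applies
  -- to both rows.
  obtain ⟨y, y', hy, hy', hyl, hyl'⟩ := exists_solution_atBot (m := fun x => K * ‖δ x‖)
    (hδc.norm.const_mul K) (fun x => (hδi x).norm.const_mul K)
    (a := fun x => (β * δ x + α * starRingEnd ℂ (δ x)) / (1 - α * β))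
    (b := fun x => (1 * δ x + α ^ 2 * starRingEnd ℂ (δ x)) / (1 - α * β))
    (c := fun x => (-β ^ 2 * δ x + (-1) * starRingEnd ℂ (δ x)) / (1 - α * β))
    (d := fun x => (-β * δ x + (-α) * starRingEnd ℂ (δ x)) / (1 - α * β))
    (by fun_prop) (by fun_prop) (by fun_prop) (by fun_prop)
    (bound _ _ _ _ (by simp only [norm_pow, norm_one]; nlinarith [sq_nonneg ‖β‖]))
    (bound _ _ _ _ (by simp only [norm_neg, norm_pow, norm_one]; nlinarith [sq_nonneg ‖α‖]))
    (μ := 2 * Complex.I * lam q0 z) (by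
      have := lam_im_nonneg hz
      simpa [mul_assoc] using this)
  have hE : ∀ x : ℝ, HasDerivAt (fun x : ℝ => Complex.exp (-(Complex.I * theta q0 τ x t z)))
      (Complex.exp (-(Complex.I * theta q0 τ x t z)) * (-(Complex.I * lam q0 z))) x := fun x =>
    ((hasDerivAt_theta x).const_mul Complex.I).neg.cexp
  -- The column is `e^{-iθ} Y (y, y')`, and `(y, y') → (1, 0)` selects the first column of `Y`.
  refine ⟨fun x => ![Complex.exp (-(Complex.I * theta q0 τ x t z)) * (y x + α * y' x),
    Complex.exp (-(Complex.I * theta q0 τ x t z)) * (β * y x + y' x)],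
    isJostColumn_zero_iff.2 ⟨isScatteringSolution_iff.2 ⟨fun x => ?_, fun x => ?_⟩, ?_, ?_⟩⟩
  · refine ((hE x).mul ((hy x).add ((hy' x).const_mul α))).congr_deriv ?_
    simp only [Matrix.cons_val_zero, Matrix.cons_val_one, Matrix.cons_val_fin_one, Pi.add_apply]
    have hq : q x t = w + δ x := by rw [hδ]; ring
    rw [hq]
    field_simp
    linear_combination (1 - α * β) * (-(y x) * e1 - y' x * e2)
  · refine ((hE x).mul (((hy x).const_mul β).add (hy' x))).congr_deriv ?_
    simp only [Matrix.cons_val_zero, Matrix.cons_val_one, Matrix.cons_val_fin_one, Pi.add_apply]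
    have hq : q x t = w + δ x := by rw [hδ]; ring
    rw [hq, map_add]
    field_simp
    linear_combination (1 - α * β) * (-(y x) * e3 - y' x * e4)
  · have h := hyl.add (hyl'.const_mul α)
    rw [mul_zero, add_zero] at h
    refine h.congr fun x => ?_
    rw [Matrix.cons_val_zero, ← mul_assoc, ← Complex.exp_add, add_neg_cancel, Complex.exp_zero,
      one_mul]
  · have h := (hyl.const_mul β).add hyl'
    rw [mul_one, add_zero, hβ] at h
    refine h.congr fun x => ?_
    rw [Matrix.cons_val_one, Matrix.cons_val_fin_one, ← mul_assoc, ← Complex.exp_add,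
      add_neg_cancel, Complex.exp_zero, one_mul, ← hβ]

end Solutions

/-! ### The symmetries of the spectral plane -/

theorem inv_im {q0 : ℝ} (z : ℂ) : (-(q0 : ℂ) ^ 2 / z).im = q0 ^ 2 / ‖z‖ ^ 2 * z.im := by
  rw [div_eq_mul_inv, ← Complex.ofReal_pow, ← Complex.ofReal_neg, Complex.im_ofReal_mul,
    Complex.inv_im, Complex.normSq_eq_norm_sq]
  ring

/-- Inversion keeps the sign of `Im z` and exchanges the inside and the outside of the circle, hence
`D₊` and `D₋`. -/
theorem side_inv {q0 : ℝ} {z : ℂ} (hz : z ≠ 0) :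
    (‖-(q0 : ℂ) ^ 2 / z‖ ^ 2 - q0 ^ 2) * (-(q0 : ℂ) ^ 2 / z).im =
      -((q0 ^ 2 / ‖z‖ ^ 2) ^ 2 * ((‖z‖ ^ 2 - q0 ^ 2) * z.im)) := by
  have hn : ‖z‖ ≠ 0 := norm_ne_zero_iff.2 hz
  have h2 : ‖-(q0 : ℂ) ^ 2 / z‖ = q0 ^ 2 / ‖z‖ := by simp
  rw [inv_im, h2]
  field_simp
  ring

theorem neg_inv_mem_upper_iff {q0 : ℝ} (hq0 : 0 < q0) {z : ℂ} (hz : z ≠ 0) :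
    -(-(q0 : ℂ) ^ 2 / z) ∈ upper q0 ↔ z ∈ upper q0 := by
  have hn : 0 < ‖z‖ := norm_pos_iff.2 hz
  have hq : (q0 : ℂ) ≠ 0 := Complex.ofReal_ne_zero.2 hq0.ne'
  have h1 : (-(q0 : ℂ) ^ 2 / z) ^ 2 + (q0 : ℂ) ^ 2
      = (q0 : ℂ) ^ 2 / z ^ 2 * (z ^ 2 + (q0 : ℂ) ^ 2) := by
    field_simp
    ring
  have h2 : 0 < (q0 ^ 2 / ‖z‖ ^ 2) ^ 2 := by positivity
  have h3 : (q0 : ℂ) ^ 2 / z ^ 2 ≠ 0 := by positivity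
  have h4 : -(q0 : ℂ) ^ 2 / z ≠ 0 := div_ne_zero (neg_ne_zero.2 (pow_ne_zero 2 hq)) hz
  simp only [upper, Set.mem_ofPred_eq, norm_neg, Complex.neg_im, neg_sq, mul_neg, side_inv hz,
    neg_neg, mul_nonneg_iff_of_pos_left h2, ne_eq, h1, mul_eq_zero, h3, false_or,
    neg_eq_zero, hz, h4]

theorem inv_inv_eq {q0 : ℝ} (hq0 : 0 < q0) {z : ℂ} (hz : z ≠ 0) :
    -(q0 : ℂ) ^ 2 / (-(q0 : ℂ) ^ 2 / z) = z := by
  have hq : (q0 : ℂ) ≠ 0 := Complex.ofReal_ne_zero.2 hq0.ne'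
  field_simp

theorem inv_ne_zero' {q0 : ℝ} (hq0 : 0 < q0) {z : ℂ} (hz : z ≠ 0) :
    -(q0 : ℂ) ^ 2 / z ≠ 0 :=
  div_ne_zero (neg_ne_zero.2 (pow_ne_zero 2 (Complex.ofReal_ne_zero.2 hq0.ne'))) hz

theorem inv_mem_upper_iff {q0 : ℝ} (hq0 : 0 < q0) {z : ℂ} (hz : z ≠ 0) :
    -(q0 : ℂ) ^ 2 / z ∈ upper q0 ↔ -z ∈ upper q0 := by
  rw [← neg_inv_mem_upper_iff hq0 (neg_ne_zero.2 hz), div_neg, neg_neg]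

theorem inv_mem_Dplus_iff {q0 : ℝ} (hq0 : 0 < q0) {z : ℂ} (hz : z ≠ 0) :
    -(q0 : ℂ) ^ 2 / z ∈ Dplus q0 ↔ z ∈ Dminus q0 := by
  have hn : 0 < ‖z‖ := norm_pos_iff.2 hz
  have h2 : 0 < (q0 ^ 2 / ‖z‖ ^ 2) ^ 2 := by positivity
  simp only [Dplus, Dminus, Set.mem_ofPred_eq, side_inv hz]
  rw [← mul_neg, mul_pos_iff_of_pos_left h2, Left.neg_pos_iff]

theorem conj_mem_Dplus_iff {q0 : ℝ} {z : ℂ} :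
    starRingEnd ℂ z ∈ Dplus q0 ↔ z ∈ Dminus q0 := by
  simp only [Dplus, Dminus, Set.mem_ofPred_eq, RCLike.norm_conj, Complex.conj_im, mul_neg,
    Left.neg_pos_iff]

/-! ### The symmetries of the scattering problem -/

/-- The symmetry `v ↦ (-v₂*, v₁*)`. -/
def conjColumn (v : ℝ → Fin 2 → ℂ) : ℝ → Fin 2 → ℂ := fun x =>
  ![-starRingEnd ℂ (v x 1), starRingEnd ℂ (v x 0)]

/-- The reflected potential `x ↦ -q(-x)`. -/
def reflect (q : ℝ → ℝ → ℂ) : ℝ → ℝ → ℂ := fun x t => -q (-x) t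

section Symmetry

variable {q : ℝ → ℝ → ℂ} {q0 τ t : ℝ} {z w : ℂ} {F : Filter ℝ} {u v : ℝ → Fin 2 → ℂ} {j : Fin 2}

theorem conjColumn_conjColumn (v : ℝ → Fin 2 → ℂ) : conjColumn (conjColumn v) = -v := by
  funext x i
  fin_cases i <;> simp [conjColumn]

theorem conjColumn_neg (v : ℝ → Fin 2 → ℂ) : conjColumn (-v) = -conjColumn v := by
  funext x i
  fin_cases i <;> simp [conjColumn]

/-- The square of `conjColumn` is `-1`. Bijectivity lets existence and uniqueness pass together
between the two columns. -/
theorem bijective_conjColumn : Function.Bijective conjColumn :=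
  Function.bijective_iff_has_inverse.2 ⟨fun v => -conjColumn v,
    fun v => neg_eq_iff_eq_neg.2 (conjColumn_conjColumn v),
    fun v => by rw [conjColumn_neg, conjColumn_conjColumn, neg_neg]⟩

theorem IsScatteringSolution.conj (hv : IsScatteringSolution q q0 t z v) :
    IsScatteringSolution q q0 t (starRingEnd ℂ z) (conjColumn v) := by
  rw [isScatteringSolution_iff] at hv ⊢
  refine ⟨fun x => ((hv.2 x).star.neg).congr_deriv ?_, fun x => (hv.1 x).star.congr_deriv ?_⟩
  · simp [conjColumn, kk_conj, ← starRingEnd_apply]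
  · simp [conjColumn, kk_conj, ← starRingEnd_apply]
    ring

theorem IsScatteringSolution.neg (hv : IsScatteringSolution q q0 t z v) :
    IsScatteringSolution q q0 t z (-v) := by
  simpa using hv.const_smul (-1)

theorem isScatteringSolution_conj_iff :
    IsScatteringSolution q q0 t (starRingEnd ℂ z) (conjColumn v) ↔
      IsScatteringSolution q q0 t z v := by
  refine ⟨fun h => ?_, fun h => h.conj⟩
  have := h.conj.neg
  rwa [conjColumn_conjColumn, neg_neg, Complex.conj_conj] at this

theorem tendsto_conj_iff {f : ℝ → ℂ} {a : ℂ} :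
    Tendsto (fun x => starRingEnd ℂ (f x)) F (𝓝 (starRingEnd ℂ a)) ↔ Tendsto f F (𝓝 a) := by
  constructor
  · intro h
    simpa [Function.comp_def] using (Complex.continuous_conj.tendsto _).comp h
  · exact fun h => (Complex.continuous_conj.tendsto _).comp h

theorem isJostColumn_conj_iff : IsJostColumn F w q q0 τ t (starRingEnd ℂ z) 1 (conjColumn v) ↔
    IsJostColumn F w q q0 τ t z 0 v := by
  rw [isJostColumn_one_iff, isJostColumn_zero_iff, isScatteringSolution_conj_iff,
    ← tendsto_conj_iff (f := fun x => _ * v x 0), ← tendsto_conj_iff (f := fun x => _ * v x 1),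
    and_comm (a := Tendsto (fun x => _ * conjColumn v x 0) _ _)]
  simp only [conjColumn, Matrix.cons_val_zero, Matrix.cons_val_one, Matrix.cons_val_fin_one,
    map_mul, ← Complex.exp_conj, Complex.conj_I, theta_conj, map_one, neg_mul, map_neg, map_div₀,
    Complex.conj_conj, mul_neg, neg_div, neg_neg]
  rw [tendsto_neg_iff]

theorem existsUnique_isJostColumn_conj :
    (∃! v, IsJostColumn F w q q0 τ t (starRingEnd ℂ z) 1 v) ↔
      ∃! v, IsJostColumn F w q q0 τ t z 0 v := by
  rw [bijective_conjColumn.existsUnique_iff]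
  simp only [isJostColumn_conj_iff]

/-- Reversing `x` negates the coefficient matrix, and `-X(k, q) = X(-k, -q)`. -/
theorem IsScatteringSolution.reflect (hv : IsScatteringSolution q q0 t z v) :
    IsScatteringSolution (reflect q) q0 t (-z) fun x => v (-x) := by
  intro x
  refine ((hv (-x)).scomp x (hasDerivAt_neg x)).congr_deriv ?_
  rw [Xmat_mulVec, Xmat_mulVec, kk_neg, HDNLS.reflect]
  ext i
  fin_cases i <;> simp [add_comm]

theorem reflect_reflect (q : ℝ → ℝ → ℂ) : reflect (reflect q) = q := by
  funext x t
  simp [reflect]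

theorem IsJostColumn.reflect {G : Filter ℝ} (hFG : Tendsto Neg.neg G F)
    (hv : IsJostColumn F w q q0 τ t z j v) :
    IsJostColumn G (-w) (reflect q) q0 τ t (-z) j fun x => v (-x) := by
  refine ⟨hv.1.reflect, ?_⟩
  have h := hv.2.comp hFG
  have hY : Ymat (-w) (-z) = Ymat w z := by
    rw [Ymat_eq, Ymat_eq, map_neg, div_neg]
    simp
  rw [hY]
  refine h.congr fun x => ?_
  simp only [Function.comp_apply, theta_neg]

theorem existsUnique_isJostColumn_reflect
    (h : ∃! v, IsJostColumn atBot (-w) (reflect q) q0 τ t (-z) j v) :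
    ∃! v, IsJostColumn atTop w q q0 τ t z j v := by
  obtain ⟨v, hv, huniq⟩ := h
  refine ⟨fun x => v (-x), ?_, fun u hu => ?_⟩
  · have := hv.reflect tendsto_neg_atTop_atBot
    simpa only [neg_neg, reflect_reflect] using this
  · funext x
    have := congrFun (huniq _ (hu.reflect tendsto_neg_atBot_atTop)) (-x)
    simpa using this

theorem isScatteringSolution_inv_iff (hq0 : 0 < q0) (hz : z ≠ 0) :
    IsScatteringSolution q q0 t (-(q0 : ℂ) ^ 2 / z) v ↔ IsScatteringSolution q q0 t z v := by
  simp only [IsScatteringSolution, kk_inv hq0 hz]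

/-- The equation depends on `z` only through `k`, which inversion fixes, while `θ` changes sign. The
second column at `-q₀²/z` therefore has the exponential behaviour of the first at `z`; the scalar
matches the columns of `Y`, using `|w| = q₀`. -/
theorem IsJostColumn.inv_one (hq0 : 0 < q0) (hw : ‖w‖ = q0) (hz : z ≠ 0)
    (hv : IsJostColumn F w q q0 τ t (-(q0 : ℂ) ^ 2 / z) 1 v) :
    IsJostColumn F w q q0 τ t z 0 ((-(Complex.I / z) * starRingEnd ℂ w) • v) := by
  have hq : (q0 : ℂ) ≠ 0 := Complex.ofReal_ne_zero.2 hq0.ne'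
  have hww : w * starRingEnd ℂ w = (q0 : ℂ) ^ 2 := by rw [Complex.mul_conj', hw]
  rw [isJostColumn_one_iff, isScatteringSolution_inv_iff hq0 hz] at hv
  obtain ⟨h, h0, h1⟩ := hv
  refine isJostColumn_zero_iff.2 ⟨h.const_smul _, ?_, ?_⟩
  · have e : (-(Complex.I / z) * starRingEnd ℂ w) *
        (-(Complex.I / (-(q0 : ℂ) ^ 2 / z)) * w) = 1 := by
      field_simp
      linear_combination (-Complex.I ^ 2) * hww - (q0 : ℂ) ^ 2 * Complex.I_sq
    rw [← e]
    refine (h0.const_mul _).congr fun x => ?_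
    rw [theta_inv hq0 _ _ _ hz, mul_neg, neg_neg, Pi.smul_apply, Pi.smul_apply, smul_eq_mul]
    ring
  · have h2 := h1.const_mul (-(Complex.I / z) * starRingEnd ℂ w)
    rw [mul_one] at h2
    refine h2.congr fun x => ?_
    rw [theta_inv hq0 _ _ _ hz, mul_neg, neg_neg, Pi.smul_apply, Pi.smul_apply, smul_eq_mul]
    ring

theorem IsJostColumn.inv_zero (hq0 : 0 < q0) (hw : ‖w‖ = q0) (hz : z ≠ 0)
    (hv : IsJostColumn F w q q0 τ t (-(q0 : ℂ) ^ 2 / z) 0 v) :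
    IsJostColumn F w q q0 τ t z 1 ((-(Complex.I / z) * w) • v) := by
  have hq : (q0 : ℂ) ≠ 0 := Complex.ofReal_ne_zero.2 hq0.ne'
  have hww : w * starRingEnd ℂ w = (q0 : ℂ) ^ 2 := by rw [Complex.mul_conj', hw]
  rw [isJostColumn_zero_iff, isScatteringSolution_inv_iff hq0 hz] at hv
  obtain ⟨h, h0, h1⟩ := hv
  refine isJostColumn_one_iff.2 ⟨h.const_smul _, ?_, ?_⟩
  · have h2 := h0.const_mul (-(Complex.I / z) * w)
    rw [mul_one] at h2
    refine h2.congr fun x => ?_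
    rw [theta_inv hq0 _ _ _ hz, mul_neg, Pi.smul_apply, Pi.smul_apply, smul_eq_mul]
    ring
  · have e : (-(Complex.I / z) * w) *
        (-(Complex.I / (-(q0 : ℂ) ^ 2 / z)) * starRingEnd ℂ w) = 1 := by
      field_simp
      linear_combination (-Complex.I ^ 2) * hww - (q0 : ℂ) ^ 2 * Complex.I_sq
    rw [← e]
    refine (h1.const_mul _).congr fun x => ?_
    rw [theta_inv hq0 _ _ _ hz, mul_neg, Pi.smul_apply, Pi.smul_apply, smul_eq_mul]
    ring

theorem isJostColumn_jostColumn (h : ∃! v, IsJostColumn F w q q0 τ t z j v) :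
    IsJostColumn F w q q0 τ t z j (jostColumn F w q q0 τ t z j) :=
  Classical.epsilon_spec h.exists

theorem jostColumn_eq (h : ∃! v, IsJostColumn F w q q0 τ t z j v)
    (hv : IsJostColumn F w q q0 τ t z j v) : jostColumn F w q q0 τ t z j = v :=
  h.unique (isJostColumn_jostColumn h) hv

theorem jostColumn_conj (h : ∃! v, IsJostColumn F w q q0 τ t z 0 v) :
    jostColumn F w q q0 τ t (starRingEnd ℂ z) 1 = conjColumn (jostColumn F w q q0 τ t z 0) :=
  jostColumn_eq (existsUnique_isJostColumn_conj.2 h)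
    (isJostColumn_conj_iff.2 (isJostColumn_jostColumn h))

theorem jostColumn_conj' (h : ∃! v, IsJostColumn F w q q0 τ t (starRingEnd ℂ z) 0 v) :
    jostColumn F w q q0 τ t z 1 =
      conjColumn (jostColumn F w q q0 τ t (starRingEnd ℂ z) 0) := by
  rw [← jostColumn_conj h, Complex.conj_conj]

end Symmetry

/-! ### Potentials with nonzero boundary values -/

/-- The hypotheses on the potential at a fixed time. -/
structure IsPotential (q0 : ℝ) (qm qp : ℂ) (q : ℝ → ℝ → ℂ) (t : ℝ) : Prop where
  pos : 0 < q0
  norm_m : ‖qm‖ = q0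
  norm_p : ‖qp‖ = q0
  cont : Continuous fun x => q x t
  lim_m : Tendsto (fun x => q x t) atBot (𝓝 qm)
  lim_p : Tendsto (fun x => q x t) atTop (𝓝 qp)
  int_m : IntegrableOn (fun x => q x t - qm) (Set.Iic 0)
  int_p : IntegrableOn (fun x => q x t - qp) (Set.Ici 0)

namespace IsPotential

variable {q : ℝ → ℝ → ℂ} {q0 t : ℝ} {qm qp z : ℂ}

theorem bounded (h : IsPotential q0 qm qp q t) : ∃ C, ∀ x, ‖q x t‖ ≤ C := by
  have hp := h.lim_p.norm.eventually_le_const (lt_add_one ‖qp‖)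
  have hm := h.lim_m.norm.eventually_le_const (lt_add_one ‖qm‖)
  obtain ⟨b, hb⟩ := eventually_atTop.1 hp
  obtain ⟨a, ha⟩ := eventually_atBot.1 hm
  obtain ⟨C, hC⟩ := (isCompact_Icc (a := a) (b := b)).exists_bound_of_continuousOn
    h.cont.continuousOn
  refine ⟨max C (max (‖qp‖ + 1) (‖qm‖ + 1)), fun x => ?_⟩
  rcases le_total x a with hx | hx
  · exact (ha x hx).trans ((le_max_right _ _).trans (le_max_right _ _))
  rcases le_total b x with hx' | hx'
  · exact (hb x hx').trans ((le_max_left _ _).trans (le_max_right _ _))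
  · exact (hC x ⟨hx, hx'⟩).trans (le_max_left _ _)

theorem reflect (h : IsPotential q0 qm qp q t) :
    IsPotential q0 (-qp) (-qm) (HDNLS.reflect q) t where
  pos := h.pos
  norm_m := by rw [norm_neg, h.norm_p]
  norm_p := by rw [norm_neg, h.norm_m]
  cont := (h.cont.comp continuous_neg).neg
  lim_m := (h.lim_p.comp tendsto_neg_atBot_atTop).neg
  lim_p := (h.lim_m.comp tendsto_neg_atTop_atBot).neg
  int_m := by
    have h1 := (((Measure.measurePreserving_neg (volume : Measure ℝ)).integrableOn_comp_preimage
      (MeasurableEquiv.neg ℝ).measurableEmbedding (s := Set.Ici 0)).2 h.int_p).neg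
    have e : (Neg.neg ⁻¹' Set.Ici 0 : Set ℝ) = Set.Iic 0 := by simp
    rw [e] at h1
    exact h1.congr (ae_of_all _ fun x => by simp [HDNLS.reflect]; ring)
  int_p := by
    have h1 := (((Measure.measurePreserving_neg (volume : Measure ℝ)).integrableOn_comp_preimage
      (MeasurableEquiv.neg ℝ).measurableEmbedding (s := Set.Iic 0)).2 h.int_m).neg
    have e : (Neg.neg ⁻¹' Set.Iic 0 : Set ℝ) = Set.Ici 0 := by simp
    rw [e] at h1
    exact h1.congr (ae_of_all _ fun x => by simp [HDNLS.reflect]; ring)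

theorem existsUnique_atBot_zero (h : IsPotential q0 qm qp q t) (τ : ℝ) (hz : z ∈ upper q0) :
    ∃! v, IsJostColumn atBot qm q q0 τ t z 0 v := by
  obtain ⟨v, hv⟩ := IsJostColumn.exists_atBot (τ := τ) h.norm_m h.cont h.int_m hz
  exact ⟨v, hv, fun u hu => hu.eq_atBot h.bounded hz hv⟩

theorem existsUnique_atTop_zero (h : IsPotential q0 qm qp q t) (τ : ℝ) (hz : -z ∈ upper q0) :
    ∃! v, IsJostColumn atTop qp q q0 τ t z 0 v :=
  existsUnique_isJostColumn_reflect (h.reflect.existsUnique_atBot_zero τ hz)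

theorem existsUnique_atBot_one (h : IsPotential q0 qm qp q t) (τ : ℝ) (hz : -z ∈ upper q0) :
    ∃! v, IsJostColumn atBot qm q q0 τ t z 1 v := by
  rw [← Complex.conj_conj z, existsUnique_isJostColumn_conj]
  exact h.existsUnique_atBot_zero τ (neg_mem_upper_iff.1 hz)

theorem existsUnique_atTop_one (h : IsPotential q0 qm qp q t) (τ : ℝ) (hz : z ∈ upper q0) :
    ∃! v, IsJostColumn atTop qp q q0 τ t z 1 v := by
  rw [← Complex.conj_conj z, existsUnique_isJostColumn_conj]
  exact h.existsUnique_atTop_zero τ (by rwa [neg_mem_upper_iff, Complex.conj_conj])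

end IsPotential

/-! ### The scattering matrix -/

theorem wr_smul_smul (a b : ℂ) (u v : Fin 2 → ℂ) : wr (a • u) (b • v) = a * b * wr u v := by
  simp only [wr, Pi.smul_apply, smul_eq_mul]
  ring

theorem wr_swap (u v : Fin 2 → ℂ) : wr u v = -wr v u := by
  simp only [wr]
  ring

theorem wr_neg_right (u v : Fin 2 → ℂ) : wr u (-v) = -wr u v := by
  simp only [wr, Pi.neg_apply]
  ring

theorem wr_conjColumn (u v : ℝ → Fin 2 → ℂ) (x : ℝ) :
    wr (conjColumn u x) (conjColumn v x) = starRingEnd ℂ (wr (u x) (v x)) := by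
  simp only [wr, conjColumn, Matrix.cons_val_zero, Matrix.cons_val_one, Matrix.cons_val_fin_one,
    map_sub, map_mul]
  ring

/-- The two exponentials cancel in the constant Wronskian, so its value is read off at the end of
the line as `det Y = γ`. -/
theorem wr_eq_gam {q : ℝ → ℝ → ℂ} {q0 τ t : ℝ} {z w : ℂ} {F : Filter ℝ} [F.NeBot]
    {u v : ℝ → Fin 2 → ℂ} (hw : ‖w‖ = q0) (hu : IsJostColumn F w q q0 τ t z 0 u)
    (hv : IsJostColumn F w q q0 τ t z 1 v) (x : ℝ) : wr (u x) (v x) = gam q0 z := by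
  rw [isJostColumn_zero_iff] at hu
  rw [isJostColumn_one_iff] at hv
  have h := (hu.2.1.mul hv.2.2).sub (hu.2.2.mul hv.2.1)
  have hww : w * starRingEnd ℂ w = (q0 : ℂ) ^ 2 := by rw [Complex.mul_conj', hw]
  have e : 1 * 1 - -(Complex.I / z) * starRingEnd ℂ w * (-(Complex.I / z) * w) = gam q0 z := by
    rw [gam, ← hww]
    linear_combination (-(w * starRingEnd ℂ w) / z ^ 2) * Complex.I_sq
  rw [e] at h
  refine tendsto_nhds_unique (tendsto_const_nhds.congr fun y => ?_) h
  have e2 : Complex.exp (Complex.I * theta q0 τ y t z)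
      * Complex.exp (-(Complex.I * theta q0 τ y t z)) = 1 := by
    rw [← Complex.exp_add, add_neg_cancel, Complex.exp_zero]
  rw [hu.1.wr_eq hv.1 x y, wr]
  linear_combination (-(u y 0 * v y 1 - u y 1 * v y 0)) * e2

theorem det_jost (F : Filter ℝ) (w : ℂ) (q : ℝ → ℝ → ℂ) (q0 τ t : ℝ) (z : ℂ) (x : ℝ) :
    (jost F w q q0 τ t z x).det =
      wr (jostColumn F w q q0 τ t z 0 x) (jostColumn F w q q0 τ t z 1 x) := by
  simp only [Matrix.det_fin_two, jost, wr, Matrix.of_apply]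
  ring

namespace IsPotential

variable {q : ℝ → ℝ → ℂ} {q0 t : ℝ} {qm qp z : ℂ}

theorem det_jost_atBot (h : IsPotential q0 qm qp q t) (τ : ℝ) (hz : z ∈ contSpec0 q0) (x : ℝ) :
    (jost atBot qm q q0 τ t z x).det = gam q0 z := by
  obtain ⟨hz1, hz2⟩ := contSpec0_subset_upper h.pos hz
  rw [det_jost, wr_eq_gam h.norm_m (isJostColumn_jostColumn (h.existsUnique_atBot_zero τ hz1))
    (isJostColumn_jostColumn (h.existsUnique_atBot_one τ hz2))]

theorem isUnit_det_jost_atBot (h : IsPotential q0 qm qp q t) (τ : ℝ) (hz : z ∈ contSpec0 q0)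
    (x : ℝ) : IsUnit (jost atBot qm q q0 τ t z x).det := by
  rw [h.det_jost_atBot τ hz, isUnit_iff_ne_zero]
  have := (mem_contSpec0_iff h.pos z).1 hz
  exact gam_ne_zero this.1 this.2.1

/-- Cramer's rule for `φ₋⁻¹ φ₊`, with `det φ₋ = γ`. -/
theorem scatteringMatrix_eq (h : IsPotential q0 qm qp q t) (τ : ℝ) (hz : z ∈ contSpec0 q0) :
    scatteringMatrix qm qp q q0 τ t z = !![s11 qm qp q q0 τ t z,
      wr (jostColumn atTop qp q q0 τ t z 1 0) (jostColumn atBot qm q q0 τ t z 1 0) / gam q0 z;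
      wr (jostColumn atBot qm q q0 τ t z 0 0) (jostColumn atTop qp q q0 τ t z 0 0) / gam q0 z,
      s22 qm qp q q0 τ t z] := by
  rw [scatteringMatrix, Matrix.inv_def, h.det_jost_atBot τ hz, Ring.inverse_eq_inv',
    Matrix.adjugate_fin_two]
  ext i j
  fin_cases i <;> fin_cases j <;>
    simp [s11, s22, wr, jost, Matrix.mul_apply, Fin.sum_univ_two] <;> ring

/-- The columns of both sides solve the same equation and agree at `x = 0`, where `S` was read off.
-/
theorem jost_atTop_eq (h : IsPotential q0 qm qp q t) (τ : ℝ) (hz : z ∈ contSpec0 q0) (x : ℝ) :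
    jost atTop qp q q0 τ t z x =
      jost atBot qm q q0 τ t z x * scatteringMatrix qm qp q q0 τ t z := by
  obtain ⟨hz1, hz2⟩ := contSpec0_subset_upper h.pos hz
  have hM0 := (isJostColumn_jostColumn (h.existsUnique_atBot_zero τ hz1)).1
  have hM1 := (isJostColumn_jostColumn (h.existsUnique_atBot_one τ hz2)).1
  have hP : ∀ j, IsScatteringSolution q q0 t z (jostColumn atTop qp q q0 τ t z j) :=
    Fin.forall_fin_two.2 ⟨(isJostColumn_jostColumn (h.existsUnique_atTop_zero τ hz2)).1,
      (isJostColumn_jostColumn (h.existsUnique_atTop_one τ hz1)).1⟩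
  have h0 : jost atTop qp q q0 τ t z 0 =
      jost atBot qm q q0 τ t z 0 * scatteringMatrix qm qp q q0 τ t z := by
    rw [scatteringMatrix, Matrix.mul_nonsing_inv_cancel_left _ _
      (h.isUnit_det_jost_atBot τ hz 0)]
  ext i j
  have e := (hP j).eq_of_eq h.bounded
    ((hM0.const_smul (scatteringMatrix qm qp q q0 τ t z 0 j)).add
      (hM1.const_smul (scatteringMatrix qm qp q q0 τ t z 1 j))) (x := 0) (by
    ext i
    have := congrFun (congrFun h0 i) j
    simp only [jost, Matrix.mul_apply, Fin.sum_univ_two, Matrix.of_apply] at this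
    simp only [Pi.add_apply, Pi.smul_apply, smul_eq_mul, this]
    ring)
  have := congrFun (congrFun e x) i
  simp only [jost, Matrix.mul_apply, Fin.sum_univ_two, Matrix.of_apply]
  simp only [Pi.add_apply, Pi.smul_apply, smul_eq_mul] at this
  rw [this]
  ring

theorem s22_eq_conj (h : IsPotential q0 qm qp q t) (τ : ℝ) (hz : z ∈ upper q0) :
    s22 qm qp q q0 τ t z = starRingEnd ℂ (s11 qm qp q q0 τ t (starRingEnd ℂ z)) := by
  have hz' : -starRingEnd ℂ z ∈ upper q0 := by rwa [neg_mem_upper_iff, Complex.conj_conj]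
  rw [s11, s22, jostColumn_conj (h.existsUnique_atBot_zero τ hz),
    jostColumn_conj' (h.existsUnique_atTop_zero τ hz'), map_div₀, ← wr_conjColumn,
    conjColumn_conjColumn, gam_conj, Complex.conj_conj, Pi.neg_apply, wr_neg_right, wr_swap]

theorem scatteringMatrix_zero_one_eq_conj (h : IsPotential q0 qm qp q t) (τ : ℝ)
    (hz : z ∈ contSpec0 q0) (hz' : starRingEnd ℂ z ∈ contSpec0 q0) :
    scatteringMatrix qm qp q q0 τ t z 0 1 =
      -starRingEnd ℂ (scatteringMatrix qm qp q q0 τ t (starRingEnd ℂ z) 1 0) := by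
  obtain ⟨h1, h2⟩ := contSpec0_subset_upper h.pos hz'
  rw [h.scatteringMatrix_eq τ hz, h.scatteringMatrix_eq τ hz']
  simp only [Matrix.of_apply, Matrix.cons_val', Matrix.cons_val_zero, Matrix.cons_val_one,
    Matrix.cons_val_fin_one]
  rw [jostColumn_conj' (h.existsUnique_atTop_zero τ h2),
    jostColumn_conj' (h.existsUnique_atBot_zero τ h1), wr_conjColumn, wr_swap, gam_conj, map_neg,
    map_div₀, Complex.conj_conj, neg_div]

/-- The two column factors and the exchange of columns contribute `q₊* q₋ / z²`, and `γ(-q₀²/z)/γ(z)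
= z²/q₀²`. Their product is `q₊*/q₋*` because `q₋ q₋* = q₀²`. -/
theorem s11_eq_inv (h : IsPotential q0 qm qp q t) (τ : ℝ) (hz : -z ∈ upper q0) :
    s11 qm qp q q0 τ t z = (starRingEnd ℂ qp / starRingEnd ℂ qm) *
      s22 qm qp q q0 τ t (-(q0 : ℂ) ^ 2 / z) := by
  have hz0 : z ≠ 0 := neg_ne_zero.1 hz.1
  have hz' := (inv_mem_upper_iff h.pos hz0).2 hz
  have hq : (q0 : ℂ) ≠ 0 := Complex.ofReal_ne_zero.2 h.pos.ne'
  have hg : gam q0 z ≠ 0 := gam_ne_zero hz0 (by simpa using hz.2.1)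
  have hqm : qm ≠ 0 := norm_ne_zero_iff.1 (h.norm_m ▸ h.pos.ne')
  have hqm' : starRingEnd ℂ qm ≠ 0 := (map_ne_zero _).2 hqm
  have hmm : qm * starRingEnd ℂ qm = (q0 : ℂ) ^ 2 := by rw [Complex.mul_conj', h.norm_m]
  rw [s11, s22, jostColumn_eq (h.existsUnique_atTop_zero τ hz)
      ((isJostColumn_jostColumn (h.existsUnique_atTop_one τ hz')).inv_one h.pos h.norm_p hz0),
    jostColumn_eq (h.existsUnique_atBot_one τ hz)
      ((isJostColumn_jostColumn (h.existsUnique_atBot_zero τ hz')).inv_zero h.pos h.norm_m hz0),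
    Pi.smul_apply, Pi.smul_apply, wr_smul_smul, wr_swap, gam_inv h.pos hz0, ← hmm]
  field_simp
  rw [Complex.I_sq]
  ring

theorem scatteringMatrix_zero_one_eq_inv (h : IsPotential q0 qm qp q t) (τ : ℝ)
    (hz : z ∈ contSpec0 q0) (hz' : -(q0 : ℂ) ^ 2 / z ∈ contSpec0 q0) :
    scatteringMatrix qm qp q q0 τ t z 0 1 = (qp / starRingEnd ℂ qm) *
      scatteringMatrix qm qp q q0 τ t (-(q0 : ℂ) ^ 2 / z) 1 0 := by
  obtain ⟨h1, h2⟩ := contSpec0_subset_upper h.pos hz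
  obtain ⟨h1', h2'⟩ := contSpec0_subset_upper h.pos hz'
  have hz0 : z ≠ 0 := h1.1
  have hq : (q0 : ℂ) ≠ 0 := Complex.ofReal_ne_zero.2 h.pos.ne'
  have hg : gam q0 z ≠ 0 := gam_ne_zero hz0 h1.2.1
  have hqm : qm ≠ 0 := norm_ne_zero_iff.1 (h.norm_m ▸ h.pos.ne')
  have hqm' : starRingEnd ℂ qm ≠ 0 := (map_ne_zero _).2 hqm
  have hmm : qm * starRingEnd ℂ qm = (q0 : ℂ) ^ 2 := by rw [Complex.mul_conj', h.norm_m]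
  rw [h.scatteringMatrix_eq τ hz, h.scatteringMatrix_eq τ hz']
  simp only [Matrix.of_apply, Matrix.cons_val', Matrix.cons_val_zero, Matrix.cons_val_one,
    Matrix.cons_val_fin_one]
  rw [jostColumn_eq (h.existsUnique_atTop_one τ h1)
      ((isJostColumn_jostColumn (h.existsUnique_atTop_zero τ h2')).inv_zero h.pos h.norm_p hz0),
    jostColumn_eq (h.existsUnique_atBot_one τ h2)
      ((isJostColumn_jostColumn (h.existsUnique_atBot_zero τ h1')).inv_zero h.pos h.norm_m hz0),
    Pi.smul_apply, Pi.smul_apply, wr_smul_smul, wr_swap, gam_inv h.pos hz0, ← hmm]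
  field_simp
  rw [Complex.I_sq]
  ring

end IsPotential

/-! ### Square integrable solutions -/

section Decay

variable {q : ℝ → ℝ → ℂ} {q0 τ t : ℝ} {z w : ℂ} {F : Filter ℝ} {u v : ℝ → Fin 2 → ℂ}

theorem IsJostColumn.isBigO_zero (hv : IsJostColumn F w q q0 τ t z 0 v) :
    v =O[F] fun x => Real.exp ((lam q0 z).im * x) := by
  have h := (hv.2.isBigO_one ℝ)
  have h1 : (fun x => Complex.exp (-(Complex.I * theta q0 τ x t z)))
      =O[F] fun x => Real.exp ((lam q0 z).im * x) := by
    refine Asymptotics.IsBigO.of_bound ‖Complex.exp (Complex.I * theta q0 τ 0 t z)‖⁻¹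
      (Eventually.of_forall fun x => le_of_eq ?_)
    rw [Complex.exp_neg, norm_inv, norm_exp_theta, mul_inv, ← Real.exp_neg, neg_neg,
      Real.norm_of_nonneg (Real.exp_pos _).le, mul_comm]
  have h2 := h1.smul h
  refine (h2.congr_left fun x => ?_).congr_right fun x => ?_
  · rw [smul_smul, ← Complex.exp_add]
    simp [sigma3]
  · simp

theorem IsJostColumn.isBigO_one (hv : IsJostColumn F w q q0 τ t z 1 v) :
    v =O[F] fun x => Real.exp (-(lam q0 z).im * x) := by
  have h := (hv.2.isBigO_one ℝ)
  have h1 : (fun x => Complex.exp (Complex.I * theta q0 τ x t z))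
      =O[F] fun x => Real.exp (-(lam q0 z).im * x) := by
    refine Asymptotics.IsBigO.of_bound ‖Complex.exp (Complex.I * theta q0 τ 0 t z)‖
      (Eventually.of_forall fun x => le_of_eq ?_)
    rw [norm_exp_theta, Real.norm_of_nonneg (Real.exp_pos _).le, mul_comm, neg_mul]
  have h2 := h1.smul h
  refine (h2.congr_left fun x => ?_).congr_right fun x => ?_
  · rw [smul_smul, ← Complex.exp_add]
    simp [sigma3]
  · simp

theorem integrableOn_sq_Iic {E : Type*} [NormedAddCommGroup E] {v : ℝ → E} (hc : Continuous v)
    {κ : ℝ} (hκ : 0 < κ) (hv : v =O[atBot] fun x => Real.exp (κ * x)) :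
    IntegrableOn (fun x => ‖v x‖ ^ 2) (Set.Iic 0) := by
  refine ((hc.norm.pow 2).locallyIntegrable.locallyIntegrableOn _).integrableOn_of_isBigO_atBot
    (hv.norm_left.pow 2)
    ⟨Set.Iic 0, Iic_mem_atBot 0, (integrableOn_exp_mul_Iic (mul_pos two_pos hκ) 0).congr
      (ae_of_all _ fun x => ?_)⟩
  beta_reduce
  rw [← Real.exp_nat_mul]
  push_cast
  ring_nf

theorem integrableOn_sq_Ici {E : Type*} [NormedAddCommGroup E] {v : ℝ → E} (hc : Continuous v)
    {κ : ℝ} (hκ : 0 < κ) (hv : v =O[atTop] fun x => Real.exp (-κ * x)) :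
    IntegrableOn (fun x => ‖v x‖ ^ 2) (Set.Ici 0) := by
  refine ((hc.norm.pow 2).locallyIntegrable.locallyIntegrableOn _).integrableOn_of_isBigO_atTop
    (hv.norm_left.pow 2)
    ⟨Set.Ioi 0, Ioi_mem_atTop 0, (exp_neg_integrableOn_Ioi 0 (mul_pos two_pos hκ)).congr
      (ae_of_all _ fun x => ?_)⟩
  beta_reduce
  rw [← Real.exp_nat_mul]
  push_cast
  ring_nf

theorem norm_wr_le (a b : Fin 2 → ℂ) : ‖wr a b‖ ≤ ‖a‖ ^ 2 + ‖b‖ ^ 2 := by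
  have h : ∀ i j, ‖a i * b j‖ ≤ ‖a‖ * ‖b‖ := fun i j => by
    rw [norm_mul]
    exact mul_le_mul (norm_le_pi_norm a i) (norm_le_pi_norm b j) (norm_nonneg _) (norm_nonneg _)
  have h2 := norm_sub_le (a 0 * b 1) (a 1 * b 0)
  rw [wr]
  nlinarith [h 0 1, h 1 0, sq_nonneg (‖a‖ - ‖b‖)]

/-- A constant dominated by `‖u‖² + ‖v‖²` is integrable on a set of infinite measure, so it is zero.
No pointwise decay of either solution is needed. -/
theorem IsScatteringSolution.wr_eq_zero (hu : IsScatteringSolution q q0 t z u)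
    (hv : IsScatteringSolution q q0 t z v) {s : Set ℝ} (hs : volume s = ⊤)
    (hui : IntegrableOn (fun x => ‖u x‖ ^ 2) s) (hvi : IntegrableOn (fun x => ‖v x‖ ^ 2) s) :
    wr (u 0) (v 0) = 0 := by
  have h : IntegrableOn (fun _ : ℝ => wr (u 0) (v 0)) s :=
    (hui.add hvi).mono' aestronglyMeasurable_const (ae_of_all _ fun x => by
      rw [hu.wr_eq hv 0 x]
      exact norm_wr_le _ _)
  rw [integrableOn_const_iff] at h
  simpa [hs] using h

theorem norm_conjColumn (v : ℝ → Fin 2 → ℂ) (x : ℝ) : ‖conjColumn v x‖ = ‖v x‖ := by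
  have h0 := norm_le_pi_norm (v x) 0
  have h1 := norm_le_pi_norm (v x) 1
  have h0' := norm_le_pi_norm (conjColumn v x) 0
  have h1' := norm_le_pi_norm (conjColumn v x) 1
  simp only [conjColumn, Matrix.cons_val_zero, Matrix.cons_val_one, Matrix.cons_val_fin_one,
    norm_neg, RCLike.norm_conj] at h0' h1'
  refine le_antisymm ((pi_norm_le_iff_of_nonneg (norm_nonneg _)).2 (Fin.forall_fin_two.2 ?_))
    ((pi_norm_le_iff_of_nonneg (norm_nonneg _)).2 (Fin.forall_fin_two.2 ⟨h1', h0'⟩))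
  simpa [conjColumn] using ⟨h1, h0⟩

theorem conj_mem_discreteSpectrum (hz : z ∈ discreteSpectrum q q0 t) :
    starRingEnd ℂ z ∈ discreteSpectrum q q0 t := by
  obtain ⟨h1, v, hv0, hv, hL⟩ := hz
  refine ⟨by simpa [contSpec] using h1, conjColumn v, fun h => hv0 ?_, hv.conj,
    (memLp_congr_norm hv.conj.continuous.aestronglyMeasurable
      hv.continuous.aestronglyMeasurable (ae_of_all _ (norm_conjColumn v))).2 hL⟩
  funext x
  have := norm_conjColumn v x
  rw [h, Pi.zero_apply, norm_zero] at this
  exact norm_eq_zero.1 this.symm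

theorem notMem_contSpec_iff (hq0 : 0 < q0) : z ∉ contSpec q0 ↔ z ∈ Dplus q0 ∨ z ∈ Dminus q0 := by
  have h : (‖z‖ ^ 2 - q0 ^ 2) * z.im = 0 ↔ z.im = 0 ∨ ‖z‖ = q0 := by
    rw [mul_eq_zero, sub_eq_zero, sq_eq_sq₀ (norm_nonneg z) hq0.le, or_comm]
  have : z ∈ contSpec q0 ↔ z.im = 0 ∨ ‖z‖ = q0 := Iff.rfl
  rw [this, ← h, ← ne_eq, ne_iff_lt_or_gt, or_comm]
  rfl

theorem notMem_Dminus_of_mem_Dplus (hz : z ∈ Dplus q0) : z ∉ Dminus q0 :=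
  fun h => lt_asymm (a := (‖z‖ ^ 2 - q0 ^ 2) * z.im) h hz

theorem mem_zeroSet_iff_of_mem_Dplus {qm qp : ℂ} (hz : z ∈ Dplus q0) :
    z ∈ zeroSet qm qp q q0 τ t ↔ s22 qm qp q q0 τ t z = 0 := by
  simp [zeroSet, hz, notMem_Dminus_of_mem_Dplus hz]

theorem mem_zeroSet_iff_of_mem_Dminus {qm qp : ℂ} (hz : z ∈ Dminus q0) :
    z ∈ zeroSet qm qp q q0 τ t ↔ s11 qm qp q q0 τ t z = 0 := by
  have hz' : z ∉ Dplus q0 := fun h => notMem_Dminus_of_mem_Dplus h hz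
  simp [zeroSet, hz, hz']

end Decay

namespace IsPotential

variable {q : ℝ → ℝ → ℂ} {q0 t : ℝ} {qm qp z : ℂ}

theorem mem_discreteSpectrum_iff_of_mem_Dplus (h : IsPotential q0 qm qp q t) (τ : ℝ)
    (hz : z ∈ Dplus q0) : z ∈ discreteSpectrum q q0 t ↔ s22 qm qp q q0 τ t z = 0 := by
  have hzu : z ∈ upper q0 := Dplus_union_contSpec0 h.pos ▸ Or.inl hz
  have hκ := lam_im_pos h.pos hz
  have hM := isJostColumn_jostColumn (h.existsUnique_atBot_zero τ hzu)
  have hP := isJostColumn_jostColumn (h.existsUnique_atTop_one τ hzu)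
  have hMi := integrableOn_sq_Iic hM.1.continuous hκ hM.isBigO_zero
  have hPi := integrableOn_sq_Ici hP.1.continuous hκ hP.isBigO_one
  rw [s22, div_eq_zero_iff, or_iff_left (gam_ne_zero hzu.1 hzu.2.1)]
  generalize jostColumn atBot qm q q0 τ t z 0 = M at *
  generalize jostColumn atTop qp q q0 τ t z 1 = P at *
  constructor
  · rintro ⟨-, v, hv0, hv, hL⟩
    have hvi := (memLp_two_iff_integrable_sq_norm hv.continuous.aestronglyMeasurable).1 hL
    -- Each Jost column is compared with `v` on the half-line where that column decays; both turn
    -- out to be multiples of `v`.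
    have h1 := hM.1.wr_eq_zero hv Real.volume_Iic hMi hvi.integrableOn
    have h2 := hP.1.wr_eq_zero hv Real.volume_Ici hPi hvi.integrableOn
    obtain ⟨a, rfl⟩ := hM.1.eq_smul_of_wr_eq_zero h.bounded hv hv0 h1
    obtain ⟨b, rfl⟩ := hP.1.eq_smul_of_wr_eq_zero h.bounded hv hv0 h2
    rw [Pi.smul_apply, Pi.smul_apply, wr_smul_smul, wr]
    ring
  · intro h0
    -- The common solution inherits decay at `-∞` from one column and at `+∞` from the other.
    obtain ⟨c, rfl⟩ := hM.1.eq_smul_of_wr_eq_zero h.bounded hP.1 hP.ne_zero h0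
    refine ⟨(notMem_contSpec_iff h.pos).2 (Or.inl hz), _, hM.ne_zero, hM.1,
      (memLp_two_iff_integrable_sq_norm hM.1.continuous.aestronglyMeasurable).2 ?_⟩
    have hc : IntegrableOn (fun x => ‖(c • P) x‖ ^ 2) (Set.Ici 0) := by
      simp only [Pi.smul_apply, norm_smul, mul_pow]
      exact hPi.const_mul _
    rw [← integrableOn_univ, ← Set.Iic_union_Ici (a := (0 : ℝ))]
    exact hMi.union hc

theorem s11_eq_zero_iff_conj (h : IsPotential q0 qm qp q t) (τ : ℝ) (hz : z ∈ Dminus q0) :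
    s11 qm qp q q0 τ t z = 0 ↔ s22 qm qp q q0 τ t (starRingEnd ℂ z) = 0 := by
  have hzu : starRingEnd ℂ z ∈ upper q0 :=
    Dplus_union_contSpec0 h.pos ▸ Or.inl (conj_mem_Dplus_iff.2 hz)
  rw [h.s22_eq_conj τ hzu, Complex.conj_conj, map_eq_zero]

theorem s11_eq_zero_iff_inv (h : IsPotential q0 qm qp q t) (τ : ℝ) (hz : z ∈ Dminus q0) :
    s11 qm qp q q0 τ t z = 0 ↔ s22 qm qp q q0 τ t (-(q0 : ℂ) ^ 2 / z) = 0 := by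
  have hzl : z ∈ Dminus q0 ∪ contSpec0 q0 := Or.inl hz
  rw [Dminus_union_contSpec0 h.pos] at hzl
  have hqm : qm ≠ 0 := norm_ne_zero_iff.1 (h.norm_m ▸ h.pos.ne')
  have hqp : qp ≠ 0 := norm_ne_zero_iff.1 (h.norm_p ▸ h.pos.ne')
  rw [h.s11_eq_inv τ hzl, mul_eq_zero, or_iff_right (div_ne_zero ((map_ne_zero _).2 hqp)
    ((map_ne_zero _).2 hqm))]

theorem discreteSpectrum_eq (h : IsPotential q0 qm qp q t) (τ : ℝ) :
    discreteSpectrum q q0 t = zeroSet qm qp q q0 τ t := by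
  have hp : ∀ z ∈ Dplus q0, z ∈ discreteSpectrum q q0 t ↔ z ∈ zeroSet qm qp q q0 τ t :=
    fun z hz => by
      rw [h.mem_discreteSpectrum_iff_of_mem_Dplus τ hz, mem_zeroSet_iff_of_mem_Dplus hz]
  have hm : ∀ z ∈ Dminus q0, z ∈ discreteSpectrum q q0 t ↔ z ∈ zeroSet qm qp q q0 τ t := by
    intro z hz
    rw [mem_zeroSet_iff_of_mem_Dminus hz, h.s11_eq_zero_iff_conj τ hz,
      ← h.mem_discreteSpectrum_iff_of_mem_Dplus τ (conj_mem_Dplus_iff.2 hz)]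
    exact ⟨conj_mem_discreteSpectrum, fun h' => by
      simpa using conj_mem_discreteSpectrum h'⟩
  ext z
  constructor
  · intro hz
    rcases (notMem_contSpec_iff h.pos).1 hz.1 with h' | h'
    · exact (hp z h').1 hz
    · exact (hm z h').1 hz
  · intro hz
    rcases id hz with h' | h'
    · exact (hm z h'.1).2 hz
    · exact (hp z h'.1).2 hz

end IsPotential

/-! ### Quartets -/

theorem inv_mem_Dminus_iff {q0 : ℝ} (hq0 : 0 < q0) {z : ℂ} (hz : z ≠ 0) :
    -(q0 : ℂ) ^ 2 / z ∈ Dminus q0 ↔ z ∈ Dplus q0 := by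
  rw [← inv_mem_Dplus_iff hq0 (inv_ne_zero' hq0 hz), inv_inv_eq hq0 hz]

theorem conj_mem_Dminus_iff {q0 : ℝ} {z : ℂ} :
    starRingEnd ℂ z ∈ Dminus q0 ↔ z ∈ Dplus q0 := by
  rw [← conj_mem_Dplus_iff, Complex.conj_conj]

theorem conj_mem_contSpec0 {q0 : ℝ} (hq0 : 0 < q0) {z : ℂ} (hz : z ∈ contSpec0 q0) :
    starRingEnd ℂ z ∈ contSpec0 q0 := by
  rw [mem_contSpec0_iff hq0] at hz ⊢
  have h : (starRingEnd ℂ z) ^ 2 + (q0 : ℂ) ^ 2 = starRingEnd ℂ (z ^ 2 + (q0 : ℂ) ^ 2) := by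
    simp
  rw [h]
  simpa only [ne_eq, map_eq_zero, RCLike.norm_conj, Complex.conj_im, mul_neg, neg_eq_zero] using hz

theorem inv_mem_contSpec0 {q0 : ℝ} (hq0 : 0 < q0) {z : ℂ} (hz : z ∈ contSpec0 q0) :
    -(q0 : ℂ) ^ 2 / z ∈ contSpec0 q0 := by
  have h1 := contSpec0_subset_upper hq0 hz
  have h0 := (inv_mem_upper_iff hq0 h1.1.1).2 h1.2
  refine (mem_contSpec0_iff hq0 _).2 ⟨h0.1, h0.2.1, ?_⟩
  rw [side_inv h1.1.1, ((mem_contSpec0_iff hq0 z).1 hz).2.2, mul_zero, neg_zero]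

/-- Here `|z| > q₀`. The sign of the imaginary part separates `z`, `-q₀²/z` from their conjugates,
and the modulus separates the two points in each pair. -/
theorem ncard_quartet {q0 : ℝ} (hq0 : 0 < q0) {z : ℂ} (hz : z ∈ Dminus q0) (him : z.im < 0) :
    (quartet q0 z).ncard = 4 := by
  have hz0 : z ≠ 0 := fun h => by simp [h] at him
  have hn : 0 < ‖z‖ := norm_pos_iff.2 hz0
  have hlt : q0 < ‖z‖ := by
    have h : (‖z‖ ^ 2 - q0 ^ 2) * z.im < 0 := hz
    have := pos_of_mul_neg_left h him.le
    nlinarith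
  have h1 : ‖-(q0 : ℂ) ^ 2 / z‖ < ‖z‖ := by
    have : ‖-(q0 : ℂ) ^ 2 / z‖ = q0 ^ 2 / ‖z‖ := by simp
    rw [this, div_lt_iff₀ hn]
    nlinarith
  have h2 : ‖-(q0 : ℂ) ^ 2 / starRingEnd ℂ z‖ < ‖starRingEnd ℂ z‖ := by
    simpa [norm_div] using h1
  have hpos : 0 < q0 ^ 2 / ‖z‖ ^ 2 := by positivity
  have im1 : (-(q0 : ℂ) ^ 2 / z).im < 0 := by
    rw [inv_im]
    exact mul_neg_of_pos_of_neg hpos him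
  have im2 : 0 < (-(q0 : ℂ) ^ 2 / starRingEnd ℂ z).im := by
    rw [inv_im, RCLike.norm_conj, Complex.conj_im]
    exact mul_pos hpos (neg_pos.2 him)
  have im3 : 0 < (starRingEnd ℂ z).im := by simpa using him
  have ne : ∀ {a b : ℂ}, a.im < 0 → 0 < b.im → a ≠ b := fun ha hb hab =>
    lt_asymm ha (hab ▸ hb)
  have n1 : z ≠ -(q0 : ℂ) ^ 2 / z := fun h => h1.ne (congrArg norm h.symm)
  have n2 : -(q0 : ℂ) ^ 2 / starRingEnd ℂ z ≠ starRingEnd ℂ z := fun h =>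
    h2.ne (congrArg norm h)
  rw [quartet, Set.ncard_insert_of_notMem, Set.ncard_insert_of_notMem, Set.ncard_pair]
  · exact (ne im1 im3).symm
  · simp only [Set.mem_insert_iff, Set.mem_singleton_iff, not_or]
    exact ⟨n2, (ne im1 im2).symm⟩
  · simp only [Set.mem_insert_iff, Set.mem_singleton_iff, not_or]
    exact ⟨ne him im2, ne him im3, n1⟩

theorem neg_sigma_mul_mul_sigma (M : Matrix (Fin 2) (Fin 2) ℂ) :
    -(sigma * M * sigma) = !![M 1 1, -M 1 0; -M 0 1, M 0 0] := by
  rw [Matrix.eta_fin_two M]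
  simp [sigma]

theorem offDiag_mul_mul_offDiag (a b c d : ℂ) (M : Matrix (Fin 2) (Fin 2) ℂ) :
    !![0, a; b, 0] * M * !![0, c; d, 0] =
      !![a * M 1 1 * d, a * M 1 0 * c; b * M 0 1 * d, b * M 0 0 * c] := by
  rw [Matrix.eta_fin_two M]
  simp

namespace IsPotential

variable {q : ℝ → ℝ → ℂ} {q0 t : ℝ} {qm qp z : ℂ}

theorem conj_mem_zeroSet (h : IsPotential q0 qm qp q t) (τ : ℝ)
    (hz : z ∈ zeroSet qm qp q q0 τ t) : starRingEnd ℂ z ∈ zeroSet qm qp q q0 τ t := by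
  rcases hz with ⟨hD, hs⟩ | ⟨hD, hs⟩
  · exact Or.inr ⟨conj_mem_Dplus_iff.2 hD, (h.s11_eq_zero_iff_conj τ hD).1 hs⟩
  · have hD' := conj_mem_Dminus_iff.2 hD
    exact Or.inl ⟨hD', (h.s11_eq_zero_iff_conj τ hD').2 (by rwa [Complex.conj_conj])⟩

theorem ne_zero_of_mem_zeroSet (h : IsPotential q0 qm qp q t) {τ : ℝ}
    (hz : z ∈ zeroSet qm qp q q0 τ t) : z ≠ 0 := by
  rcases hz with ⟨hD, -⟩ | ⟨hD, -⟩
  · exact (ne_of_side_ne_zero h.pos (ne_of_lt hD)).1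
  · exact (ne_of_side_ne_zero h.pos (ne_of_gt hD)).1

theorem inv_mem_zeroSet (h : IsPotential q0 qm qp q t) (τ : ℝ)
    (hz : z ∈ zeroSet qm qp q q0 τ t) : -(q0 : ℂ) ^ 2 / z ∈ zeroSet qm qp q q0 τ t := by
  have hz0 := h.ne_zero_of_mem_zeroSet hz
  rcases hz with ⟨hD, hs⟩ | ⟨hD, hs⟩
  · exact Or.inr ⟨(inv_mem_Dplus_iff h.pos hz0).2 hD, (h.s11_eq_zero_iff_inv τ hD).1 hs⟩
  · have hD' := (inv_mem_Dminus_iff h.pos hz0).2 hD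
    exact Or.inl ⟨hD', (h.s11_eq_zero_iff_inv τ hD').2 (by rwa [inv_inv_eq h.pos hz0])⟩

theorem zeroSet_eq (h : IsPotential q0 qm qp q t) (τ : ℝ) :
    zeroSet qm qp q q0 τ t =
      ⋃ z ∈ {z : ℂ | z ∈ Dminus q0 ∧ z.im < 0 ∧ s11 qm qp q q0 τ t z = 0}, quartet q0 z := by
  refine Set.Subset.antisymm (fun z hz => ?_) (Set.iUnion₂_subset fun z hz w hw => ?_)
  · have hz0 := h.ne_zero_of_mem_zeroSet hz
    have hn : 0 < ‖z‖ := norm_pos_iff.2 hz0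
    have hpos : 0 < q0 ^ 2 / ‖z‖ ^ 2 := div_pos (pow_pos h.pos 2) (pow_pos hn 2)
    have key : ∀ y, y ∈ zeroSet qm qp q q0 τ t → y ∈ Dminus q0 → y.im < 0 → z ∈ quartet q0 y →
        z ∈ ⋃ z ∈ {z : ℂ | z ∈ Dminus q0 ∧ z.im < 0 ∧ s11 qm qp q q0 τ t z = 0},
          quartet q0 z := fun y hy hD him hq =>
      Set.mem_iUnion₂.2 ⟨y, ⟨hD, him, (mem_zeroSet_iff_of_mem_Dminus hD).1 hy⟩, hq⟩
    -- The four cases are the components cut out by the circle and the real axis. In each, one of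
    -- the four symmetries moves `z` outside the circle and below the axis; each is an involution,
    -- so `z` lies in the quartet of its image.
    rcases id hz with ⟨hD, -⟩ | ⟨hD, -⟩
    · have him : z.im ≠ 0 := fun h0 => 
        (ne_of_lt (a := (‖z‖ ^ 2 - q0 ^ 2) * z.im) hD) (by rw [h0, mul_zero])
      rcases him.lt_or_gt with him | him
      · exact key z hz hD him (Or.inl rfl)
      · have hc0 : starRingEnd ℂ z ≠ 0 := (map_ne_zero _).2 hz0
        refine key (-(q0 : ℂ) ^ 2 / starRingEnd ℂ z)
          (h.inv_mem_zeroSet τ (h.conj_mem_zeroSet τ hz))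
          ((inv_mem_Dminus_iff h.pos hc0).2 (conj_mem_Dplus_iff.2 hD)) ?_ (Or.inr (Or.inl ?_))
        · rw [inv_im, RCLike.norm_conj, Complex.conj_im]
          exact mul_neg_of_pos_of_neg hpos (neg_neg_iff_pos.2 him)
        · rw [map_div₀, map_neg, map_pow, Complex.conj_ofReal, Complex.conj_conj,
            inv_inv_eq h.pos hz0]
    · have him : z.im ≠ 0 := fun h0 => 
        (ne_of_gt (a := (‖z‖ ^ 2 - q0 ^ 2) * z.im) hD) (by rw [h0, mul_zero])
      rcases him.lt_or_gt with him | him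
      · refine key (-(q0 : ℂ) ^ 2 / z) (h.inv_mem_zeroSet τ hz)
          ((inv_mem_Dminus_iff h.pos hz0).2 hD) ?_ (Or.inr (Or.inr (Or.inr ?_)))
        · rw [inv_im]
          exact mul_neg_of_pos_of_neg hpos him
        · exact (inv_inv_eq h.pos hz0).symm
      · refine key (starRingEnd ℂ z) (h.conj_mem_zeroSet τ hz) (conj_mem_Dminus_iff.2 hD) ?_
          (Or.inr (Or.inr (Or.inl (Complex.conj_conj z).symm)))
        rw [Complex.conj_im]
        exact neg_neg_iff_pos.2 him
  · have hz' : z ∈ zeroSet qm qp q q0 τ t := Or.inl ⟨hz.1, hz.2.2⟩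
    rcases hw with rfl | rfl | rfl | rfl
    · exact hz'
    · exact h.inv_mem_zeroSet τ (h.conj_mem_zeroSet τ hz')
    · exact h.conj_mem_zeroSet τ hz'
    · exact h.inv_mem_zeroSet τ hz'

/-! ### The symmetries of `S` in matrix form -/

theorem scatteringMatrix_zero_zero (h : IsPotential q0 qm qp q t) (τ : ℝ)
    (hz : z ∈ contSpec0 q0) :
    scatteringMatrix qm qp q q0 τ t z 0 0 = s11 qm qp q q0 τ t z := by
  rw [h.scatteringMatrix_eq τ hz]
  rfl

theorem scatteringMatrix_one_one (h : IsPotential q0 qm qp q t) (τ : ℝ)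
    (hz : z ∈ contSpec0 q0) :
    scatteringMatrix qm qp q q0 τ t z 1 1 = s22 qm qp q q0 τ t z := by
  rw [h.scatteringMatrix_eq τ hz]
  rfl

theorem scatteringMatrix_eq_conj (h : IsPotential q0 qm qp q t) (τ : ℝ)
    (hz : z ∈ contSpec0 q0) :
    scatteringMatrix qm qp q q0 τ t z = -(sigma *
      (scatteringMatrix qm qp q q0 τ t (starRingEnd ℂ z)).map (starRingEnd ℂ) * sigma) := by
  have hz' := conj_mem_contSpec0 h.pos hz
  have hu := contSpec0_subset_upper h.pos hz
  have hu' := contSpec0_subset_upper h.pos hz'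
  have e01 := h.scatteringMatrix_zero_one_eq_conj τ hz hz'
  have e10 := h.scatteringMatrix_zero_one_eq_conj τ hz' (by rwa [Complex.conj_conj])
  have e11 := h.s22_eq_conj τ hu.1
  have e00 := h.s22_eq_conj τ hu'.1
  rw [Complex.conj_conj] at e10 e00
  rw [neg_sigma_mul_mul_sigma, Matrix.eta_fin_two (scatteringMatrix qm qp q q0 τ t z)]
  simp only [Matrix.map_apply, e01, e10, h.scatteringMatrix_zero_zero τ hz,
    h.scatteringMatrix_zero_zero τ hz', h.scatteringMatrix_one_one τ hz,
    h.scatteringMatrix_one_one τ hz', e00, e11, map_neg, neg_neg, Complex.conj_conj]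

theorem scatteringMatrix_eq_inv (h : IsPotential q0 qm qp q t) (τ : ℝ)
    (hz : z ∈ contSpec0 q0) :
    scatteringMatrix qm qp q q0 τ t z = (sigma3 * Qmat qm)⁻¹ *
      scatteringMatrix qm qp q q0 τ t (-(q0 : ℂ) ^ 2 / z) * (sigma3 * Qmat qp) := by
  have hz' := inv_mem_contSpec0 h.pos hz
  have hu := contSpec0_subset_upper h.pos hz
  have hu' := contSpec0_subset_upper h.pos hz'
  have e01 := h.scatteringMatrix_zero_one_eq_inv τ hz hz'
  -- Using the relations at `-q₀²/z` as well as at `z` supplies the two remaining entries, since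
  -- inversion is an involution.
  have e10 := h.scatteringMatrix_zero_one_eq_inv τ hz' (by rwa [inv_inv_eq h.pos hu.1.1])
  have e00 := h.s11_eq_inv τ hu.2
  have e11 := h.s11_eq_inv τ hu'.2
  rw [inv_inv_eq h.pos hu.1.1] at e10 e11
  have hqm : qm ≠ 0 := norm_ne_zero_iff.1 (h.norm_m ▸ h.pos.ne')
  have hqm' : starRingEnd ℂ qm ≠ 0 := (map_ne_zero _).2 hqm
  have hmp : qm * starRingEnd ℂ qm = qp * starRingEnd ℂ qp := by
    rw [Complex.mul_conj', Complex.mul_conj', h.norm_m, h.norm_p]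
  have hinv : (sigma3 * Qmat qm)⁻¹ = !![0, (starRingEnd ℂ qm)⁻¹; qm⁻¹, 0] := by
    refine Matrix.inv_eq_right_inv ?_
    rw [sigma3_mul_Qmat]
    ext i j
    fin_cases i <;> fin_cases j <;> simp [hqm, hqm']
  rw [hinv, sigma3_mul_Qmat, offDiag_mul_mul_offDiag,
    Matrix.eta_fin_two (scatteringMatrix qm qp q q0 τ t z), e01, e10,
    h.scatteringMatrix_zero_zero τ hz, h.scatteringMatrix_zero_zero τ hz',
    h.scatteringMatrix_one_one τ hz, h.scatteringMatrix_one_one τ hz', e00, e11]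
  -- The factors cancel because `|q₋| = |q₊|`.
  have key : ∀ x : ℂ, x = qm⁻¹ * (qp / starRingEnd ℂ qm * x) * starRingEnd ℂ qp := by
    intro x
    field_simp
    linear_combination x * hmp
  have key' : ∀ x : ℂ, x = qm⁻¹ * (starRingEnd ℂ qp / starRingEnd ℂ qm * x) * qp := by
    intro x
    field_simp
    linear_combination x * hmp
  rw [← key, ← key']
  congr 2
  all_goals ring_nf

end IsPotential

end HDNLS

theorem theorem2p5 (q0 τ : ℝ) (hq0 : 0 < q0) (qm qp : ℂ) (hqm : ‖qm‖ = q0) (hqp : ‖qp‖ = q0)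
    (q : ℝ → ℝ → ℂ)
    (hcont : ∀ t : ℝ, Continuous fun x : ℝ => q x t)
    (hlimm : ∀ t : ℝ, Tendsto (fun x : ℝ => q x t) atBot (𝓝 qm))
    (hlimp : ∀ t : ℝ, Tendsto (fun x : ℝ => q x t) atTop (𝓝 qp))
    (hintm : ∀ t : ℝ, IntegrableOn (fun x : ℝ => q x t - qm) (Set.Iic 0) volume)
    (hintp : ∀ t : ℝ, IntegrableOn (fun x : ℝ => q x t - qp) (Set.Ici 0) volume)
    (t : ℝ) :
    -- the Jost columns exist and are unique where they are used
    (∀ z ∈ HDNLS.Dplus q0 ∪ HDNLS.contSpec0 q0,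
      (∃! v, HDNLS.IsJostColumn atBot qm q q0 τ t z 0 v) ∧
      (∃! v, HDNLS.IsJostColumn atTop qp q q0 τ t z 1 v)) ∧
    (∀ z ∈ HDNLS.Dminus q0 ∪ HDNLS.contSpec0 q0,
      (∃! v, HDNLS.IsJostColumn atBot qm q q0 τ t z 1 v) ∧
      (∃! v, HDNLS.IsJostColumn atTop qp q q0 τ t z 0 v)) ∧
    -- `S` is determined by `φ₊ = φ₋ S`, and `s₁₁`, `s₂₂` are its diagonal entries
    (∀ z ∈ HDNLS.contSpec0 q0,
      (∀ x : ℝ, IsUnit (HDNLS.jost atBot qm q q0 τ t z x).det ∧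
        HDNLS.jost atTop qp q q0 τ t z x =
          HDNLS.jost atBot qm q q0 τ t z x * HDNLS.scatteringMatrix qm qp q q0 τ t z) ∧
      HDNLS.scatteringMatrix qm qp q q0 τ t z 0 0 = HDNLS.s11 qm qp q q0 τ t z ∧
      HDNLS.scatteringMatrix qm qp q q0 τ t z 1 1 = HDNLS.s22 qm qp q q0 τ t z) ∧
    -- the two symmetries of the scattering matrix
    (∀ z ∈ HDNLS.contSpec0 q0,
      HDNLS.scatteringMatrix qm qp q q0 τ t z =
        -(HDNLS.sigma *
          (HDNLS.scatteringMatrix qm qp q q0 τ t (starRingEnd ℂ z)).map (starRingEnd ℂ) *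
          HDNLS.sigma) ∧
      HDNLS.scatteringMatrix qm qp q q0 τ t z =
        (HDNLS.sigma3 * HDNLS.Qmat qm)⁻¹ *
          HDNLS.scatteringMatrix qm qp q q0 τ t (-(q0 : ℂ) ^ 2 / z) *
          (HDNLS.sigma3 * HDNLS.Qmat qp)) ∧
    -- the relations between the entries
    (∀ z ∈ HDNLS.Dplus q0 ∪ HDNLS.contSpec0 q0,
      HDNLS.s22 qm qp q q0 τ t z =
        starRingEnd ℂ (HDNLS.s11 qm qp q q0 τ t (starRingEnd ℂ z))) ∧
    (∀ z ∈ HDNLS.contSpec0 q0,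
      HDNLS.scatteringMatrix qm qp q q0 τ t z 0 1 =
        -starRingEnd ℂ (HDNLS.scatteringMatrix qm qp q q0 τ t (starRingEnd ℂ z) 1 0)) ∧
    (∀ z ∈ HDNLS.Dminus q0 ∪ HDNLS.contSpec0 q0,
      HDNLS.s11 qm qp q q0 τ t z =
        (starRingEnd ℂ qp / starRingEnd ℂ qm) *
          HDNLS.s22 qm qp q q0 τ t (-(q0 : ℂ) ^ 2 / z)) ∧
    (∀ z ∈ HDNLS.contSpec0 q0,
      HDNLS.scatteringMatrix qm qp q q0 τ t z 0 1 =
        (qp / starRingEnd ℂ qm) *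
          HDNLS.scatteringMatrix qm qp q q0 τ t (-(q0 : ℂ) ^ 2 / z) 1 0) ∧
    -- the zeros and the discrete spectrum consist of quartets of four distinct points
    (∀ z ∈ HDNLS.Dminus q0, z.im < 0 → (HDNLS.quartet q0 z).ncard = 4) ∧
    HDNLS.zeroSet qm qp q q0 τ t =
      (⋃ z ∈ {z : ℂ | z ∈ HDNLS.Dminus q0 ∧ z.im < 0 ∧ HDNLS.s11 qm qp q q0 τ t z = 0},
        HDNLS.quartet q0 z) ∧
    HDNLS.discreteSpectrum q q0 t = HDNLS.zeroSet qm qp q q0 τ t := by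
  have h : HDNLS.IsPotential q0 qm qp q t :=
    ⟨hq0, hqm, hqp, hcont t, hlimm t, hlimp t, hintm t, hintp t⟩
  rw [HDNLS.Dplus_union_contSpec0 hq0, HDNLS.Dminus_union_contSpec0 hq0]
  refine ⟨fun z hz => ⟨h.existsUnique_atBot_zero τ hz, h.existsUnique_atTop_one τ hz⟩,
    fun z hz => ⟨h.existsUnique_atBot_one τ hz, h.existsUnique_atTop_zero τ hz⟩,
    fun z hz => ⟨fun x => ⟨h.isUnit_det_jost_atBot τ hz x, h.jost_atTop_eq τ hz x⟩,
      h.scatteringMatrix_zero_zero τ hz, h.scatteringMatrix_one_one τ hz⟩,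
    fun z hz => ⟨h.scatteringMatrix_eq_conj τ hz, h.scatteringMatrix_eq_inv τ hz⟩,
    fun z hz => h.s22_eq_conj τ hz,
    fun z hz => h.scatteringMatrix_zero_one_eq_conj τ hz (HDNLS.conj_mem_contSpec0 hq0 hz),
    fun z hz => h.s11_eq_inv τ hz,
    fun z hz => h.scatteringMatrix_zero_one_eq_inv τ hz (HDNLS.inv_mem_contSpec0 hq0 hz),
    fun z hz him => HDNLS.ncard_quartet hq0 hz him, h.zeroSet_eq τ, h.discreteSpectrum_eq τ⟩
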